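/- **Setting.** Let $1\le d\le D$. A *polyhedral hypergraph* $\Omega\subset\mathbb R^D$ of local dimension $d$ consists of finitely many hyperedges $E\in\mathcal E_h$, which are bounded connected polyhedra, each open in a $d$-dimensional affine subspace, and finitely many hypernodes $N\in\mathcal N_h$, which are closed flat $(d-1)$-dimensional polytopal faces of the hyperedges (points if $d=1$). Every hypernode lies in some $\partial E$; each $\partial E$ is a union of hypernodes; distinct hypernodes overlap only in sets of $(d-1)$-dimensional measure zero; if $N\cap\partial E$ has positive $(d-1)$-dimensional measure, then $N\subset\partial E$; and each $E$ lies locally on one side of each of its faces $N$, so that its outward unit normal $\mathbf n_E|_N$ is defined. A hypernode may belong to the boundaries of more than two hyperedges. $\Omega$ is connected: any two hyperedges are joined by a chain of hyperedges in which consecutive ones share a hypernode. For $d=1$, $\Omega$ is called a graph and its hyperedges (straight segments) edges; meshes of domains in $\mathbb R^d$ are included as special cases with $D=d$. Boundary hypernodes are those contained in exactly one $\partial E$; the Dirichlet boundary $\Gamma_{\rm D}$ is the union of a positive number of boundary hypernodes. Let $\kappa\in L^\infty(\Omega)$ with $\kappa\ge\kappa_0>0$ a.e. for some constant $\kappa_0$,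 let $0\le f\in L^2(\Omega)$, and $\tau_E\ge0$. Given finite-dimensional local spaces $U(E)$, $\mathbf Q(E)$, $M(N)$ (of scalar functions, tangential vector fields, and scalar functions, respectively) and $g_{{\rm D},h}\ge0$ on $\Gamma_{\rm D}$ with $g_{{\rm D},h}|_N\in M(N)$ for $N\subset\Gamma_{\rm D}$, a *solution of the HDG method* is a triple $(u_h,\mathbf q_h,\lambda_h)$ with $u_h|_E\in U(E)$, $\mathbf q_h|_E\in\mathbf Q(E)$, $\lambda_h|_N\in M(N)$ and $\lambda_h=g_{{\rm D},h}$ on $\Gamma_{\rm D}$ such that for all $E\in\mathcal E_h$ $$\int_E\kappa^{-1}\mathbf q_h\cdot\mathbf p-\int_E u_h\,\nabla\!\cdot\mathbf p=-\int_{\partial E}\lambda_h\,\mathbf p\cdot\mathbf n_E\,d\sigma\qquad\forall\,\mathbf p\in\mathbf Q(E),$$ $$\int_E v\,\nabla\!\cdot\mathbf q_h+\tau_E\int_{\partial E}u_hv\,d\sigma=\tau_E\int_{\partial E}\lambda_hv\,d\sigma+\int_E fv\qquad\forall\,v\in U(E),$$ and $$\sum_{E\in\mathcal E_h}\int_{\partial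 E}\mu\,\bigl(\mathbf q_h\cdot\mathbf n_E+\tau_E(u_h-\lambda_h)\bigr)\,d\sigma=0$$ for all $\mu$ with $\mu|_N\in M(N)$ for every $N\in\mathcal N_h$ and $\mu=0$ on $\Gamma_{\rm D}$. Throughout, $M(N)=P_0(N)$ (the constants). $P_k$ denotes polynomials of total degree at most $k$, and $Q_1$ polynomials of degree at most $1$ in each variable, in local Cartesian coordinates on $E$ (parallel to the sides if $E$ is a rectangle). In the same coordinates, $RT_0(E)=\{\mathbf c+a\mathbf x:\mathbf c\in\mathbb R^d,\,a\in\mathbb R\}$ for simplices and $RT_0(E)=\{\mathbf c+(a_1x_1,\dots,a_dx_d)^T:\mathbf c,\mathbf a\in\mathbb R^d\}$ for $d$-rectangles. **Theorem (Nonnegativity of solutions).** 1. Let $\Omega$ be a graph, $U(E)=Q(E)=P_1(E)$, $\tau_E>0$, and $\kappa|_E$ constant for all $E$. Then every HDG solution satisfies $\lambda_h\ge0$, and the mean value of $u_h$ on each $E\in\mathcal E_h$ is nonnegative. If, additionally, $f$ is constant on each $E$, then $u_h\ge0$. 2. Let $\Omega$ be a graph, $\tau_E>0$, and $\kappa|_E$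 constant for all $E$, and for each $E$ let $(U(E),Q(E))$ be one of $(P_1(E),P_0(E))$, $(P_0(E),P_1(E))$, $(P_0(E),P_0(E))$. Then every HDG solution satisfies $u_h\ge0$ and $\lambda_h\ge0$. 3. (LDG-H) Let $d\ge2$, $U(E)=P_0(E)$, $\mathbf Q(E)=P_0(E)^d$ and $\tau_E>0$ for all $E$. Suppose that each $E\in\mathcal E_h$ satisfies at least one of the following conditions: (a) $\mathbf n_E|_N\cdot\mathbf n_E|_{N'}\le0$ for all $N\ne N'$ in $\mathcal N_h$ with $N,N'\subset\partial E$; (b) $\displaystyle\tau_E\ge\frac{|\partial E|}{\int_E\kappa^{-1}\,d\mathbf x}$. Then every HDG solution satisfies $\lambda_h\ge0$ and $u_h\ge0$. 4. (RT-H) Let $d\ge2$, let all $E$ be simplices whose hypernodes are their facets, $U(E)=P_0(E)$, $\mathbf Q(E)=RT_0(E)$, $\tau_E=0$, and $\kappa|_E$ constant for all $E$. If (a) holds for all $E$, then every HDG solution satisfies $\lambda_h\ge0$ and $u_h\ge0$. 5. Let $d=2$ and let all $E$ be rectangles whose hypernodes are their four sides. Let $\kappa|_E=\kappa_E$ be constant,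 $\tau_E>0$ and $U(E)=P_0(E)$ for all $E$, and for each $E$ let $\mathbf Q(E)$ be one of $Q_1(E)^2$, $P_1(E)^2$, $RT_0(E)$ (rectangular version). Then all these HDG methods are equivalent, i.e. a triple $(u_h,\mathbf q_h,\lambda_h)$ solves the method for one choice of the spaces $\mathbf Q(E)$ if and only if it solves it for any other. Moreover, there is a function $C$ with positive values, depending on nothing but the aspect ratio $\varrho_E\ge1$ (longer over shorter side) at which it is evaluated, such that, if $$\tau_E\ge C(\varrho_E)\,\frac{\kappa_E}{\operatorname{diam}E}\qquad\forall E\in\mathcal E_h,$$ then every HDG solution satisfies $\lambda_h\ge0$ and $u_h\ge0$. For each $E$ that is a square of side length $h$, the condition on $\tau_E$ can be replaced by $\tau_E\ge 2\kappa_E/h$. -/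

import Mathlib

open MeasureTheory Set
open scoped RealInnerProductSpace

noncomputable section

namespace HDG

/-- `d`-dimensional Euclidean space. -/
abbrev Euc (d : ℕ) := EuclideanSpace ℝ (Fin d)

/-! ### Polyhedral hypergraphs -/

/-- A flat `k`-dimensional polytopal piece of Euclidean space: a finite union of convex hulls of
finite sets, contained in a `k`-dimensional affine subspace and of positive `k`-dimensional measure.
For `k = 0` this is a single point. -/
def IsFlatPolytope {D : ℕ} (k : ℕ) (S : Set (Euc D)) : Prop :=
  (∃ T : Finset (Finset (Euc D)), S = ⋃ t ∈ T, convexHull ℝ (t : Set (Euc D))) ∧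
  (∃ A : AffineSubspace ℝ (Euc D), Module.finrank ℝ A.direction = k ∧ S ⊆ A) ∧
  0 < μHE[k] S

/-- `w` is the outward unit normal vector to the open set `E` on the part `F` of its boundary:
near almost every point `x` of `F` (with respect to the surface measure), `E` is the half-space
of all `y` with `(y - x) · w < 0`. -/
def IsOutwardNormal {d : ℕ} (E F : Set (Euc d)) (w : Euc d) : Prop :=
  ‖w‖ = 1 ∧ ∀ᵐ x ∂(μHE[d - 1].restrict F), ∃ r > 0, ∀ y ∈ Metric.ball x r, y ∈ E ↔ ⟪y - x, w⟫ < 0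

/-- A hypergraph in `ℝ^D` whose hyperedges are `d`-dimensional flat open polyhedra and whose
hypernodes are the `(d-1)`-dimensional faces of the hyperedges. Hyperedges are indexed by `ι`,
hypernodes by `ν`. Each hyperedge is the image of an open polyhedron `dom e` in `ℝ^d` under an
affine isometry `chart e` (local Cartesian coordinates on the hyperedge). A hypernode may lie in
the boundary of arbitrarily many hyperedges. Graphs are the case `d = 1`, meshes of domains in
`ℝ^d` are contained in the case `d = D`. -/
structure PolyhedralHypergraph (d D : ℕ) (ι ν : Type*) where
  /-- the hyperedge in local coordinates -/
  dom : ι → Set (Euc d)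
  /-- the local coordinates -/
  chart : ι → (Euc d →ᵃⁱ[ℝ] Euc D)
  /-- the hypernodes -/
  node : ν → Set (Euc D)
  isOpen_dom : ∀ e, IsOpen (dom e)
  isConnected_dom : ∀ e, IsConnected (dom e)
  isBounded_dom : ∀ e, Bornology.IsBounded (dom e)
  flat_node : ∀ n, IsFlatPolytope (d - 1) (node n)
  /-- every hypernode lies in the boundary of a hyperedge -/
  node_subset : ∀ n, ∃ e, node n ⊆ chart e '' frontier (dom e)
  /-- the boundary of a hyperedge is a union of hypernodes -/
  boundary_eq : ∀ e, chart e '' frontier (dom e) =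
    ⋃ n ∈ {n | node n ⊆ chart e '' frontier (dom e)}, node n
  /-- a hypernode meeting the boundary of a hyperedge in a set of positive measure is contained
  in that boundary -/
  conforming : ∀ e n, 0 < μHE[d - 1] (node n ∩ chart e '' frontier (dom e)) →
    node n ⊆ chart e '' frontier (dom e)
  /-- distinct hypernodes do not overlap -/
  inter_null : ∀ n n', n ≠ n' → μHE[d - 1] (node n ∩ node n') = 0
  /-- each hyperedge lies locally on one side of its faces -/
  exists_normal : ∀ e n, node n ⊆ chart e '' frontier (dom e) →
    ∃ w, IsOutwardNormal (dom e) (chart e ⁻¹' node n) w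

namespace PolyhedralHypergraph

variable {d D : ℕ} {ι ν : Type*} (G : PolyhedralHypergraph d D ι ν)

/-- The hypernode `n` is contained in the boundary of the hyperedge `e`. -/
def Incident (e : ι) (n : ν) : Prop := G.node n ⊆ G.chart e '' frontier (G.dom e)

/-- A hypernode in the local coordinates of a hyperedge. -/
def face (e : ι) (n : ν) : Set (Euc d) := G.chart e ⁻¹' G.node n

/-- The outward unit normal vector to the hyperedge `e` on its face `n`, in local coordinates. -/
def normal (e : ι) (n : ν) : Euc d :=
  Classical.epsilon (IsOutwardNormal (G.dom e) (G.face e n))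

/-- Boundary hypernodes lie in the boundary of exactly one hyperedge. -/
def IsBoundaryNode (n : ν) : Prop := ∃! e, G.Incident e n

/-- Any two hyperedges are joined by a chain of hyperedges in which consecutive ones share a
hypernode. -/
def Connected : Prop :=
  ∀ e e', Relation.ReflTransGen (fun a b => ∃ n, G.Incident a n ∧ G.Incident b n) e e'

/-- The set of all faces of a hyperedge, in local coordinates. -/
def faces (e : ι) : Set (Set (Euc d)) := {F | ∃ n, G.Incident e n ∧ G.face e n = F}

/-- The hyperedge `e` is a `d`-simplex, its hypernodes being the facets of the simplex. -/
def IsSimplex (e : ι) : Prop :=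
  ∃ v : Fin (d + 1) → Euc d, AffineIndependent ℝ v ∧
    G.dom e = interior (convexHull ℝ (range v)) ∧
    G.faces e = {F | ∃ i, F = convexHull ℝ (v '' {i}ᶜ)}

/-- In its local coordinates, the hyperedge `e` is the `d`-rectangle `∏ (a i, b i)`, its hypernodes
being the facets of this rectangle. -/
def IsRectangle (e : ι) (a b : Fin d → ℝ) : Prop :=
  (∀ i, a i < b i) ∧ G.dom e = {x | ∀ i, a i < x i ∧ x i < b i} ∧
    G.faces e = {F | ∃ i, F = {x | (∀ j, a j ≤ x j ∧ x j ≤ b j) ∧ x i = a i} ∨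
      F = {x | (∀ j, a j ≤ x j ∧ x j ≤ b j) ∧ x i = b i}}

open Classical in
/-- `∫_{∂E} F dσ`; the integrand on each face `n ⊆ ∂E` is `F n`, in local coordinates. -/
def bdryIntegral [Fintype ν] (e : ι) (F : ν → Euc d → ℝ) : ℝ :=
  ∑ n with G.Incident e n, ∫ x in G.face e n, F n x ∂μHE[d - 1]

end PolyhedralHypergraph

/-! ### Discrete spaces -/

/-- `P_0`: constant functions. -/
def P0 (X : Type*) : Submodule ℝ (X → ℝ) where
  carrier := {v | ∃ c : ℝ, ∀ x, v x = c}
  zero_mem' := ⟨0, fun _ => rfl⟩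
  add_mem' := by
    rintro v w ⟨c, hc⟩ ⟨c', hc'⟩
    exact ⟨c + c', fun x => by simp [hc, hc']⟩
  smul_mem' := by
    rintro r v ⟨c, hc⟩
    exact ⟨r * c, fun x => by simp [hc]⟩

/-- `P_1`: polynomials of total degree at most one. -/
def P1 (d : ℕ) : Submodule ℝ (Euc d → ℝ) where
  carrier := {v | ∃ (c : ℝ) (b : Fin d → ℝ), ∀ x, v x = c + ∑ i, b i * x i}
  zero_mem' := ⟨0, 0, fun _ => by simp⟩
  add_mem' := by
    rintro v w ⟨c, b, h⟩ ⟨c', b', h'⟩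
    exact ⟨c + c', b + b', fun x => by simp [h, h', add_mul, Finset.sum_add_distrib]; ring⟩
  smul_mem' := by
    rintro r v ⟨c, b, h⟩
    exact ⟨r * c, fun i => r * b i, fun x => by simp [h, mul_add, Finset.mul_sum, mul_assoc]⟩

/-- `Q_1`: polynomials of degree at most one in each variable. -/
def Q1 (d : ℕ) : Submodule ℝ (Euc d → ℝ) where
  carrier := {v | ∃ c : Finset (Fin d) → ℝ, ∀ x, v x = ∑ S, c S * ∏ i ∈ S, x i}
  zero_mem' := ⟨0, fun _ => by simp⟩
  add_mem' := by
    rintro v w ⟨c, h⟩ ⟨c', h'⟩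
    exact ⟨c + c', fun x => by simp [h, h', add_mul, Finset.sum_add_distrib]⟩
  smul_mem' := by
    rintro r v ⟨c, h⟩
    exact ⟨fun S => r * c S, fun x => by simp [h, Finset.mul_sum, mul_assoc]⟩

/-- `P^d`: vector fields with all components in `P`. -/
def vec {d : ℕ} (P : Submodule ℝ (Euc d → ℝ)) : Submodule ℝ (Euc d → Euc d) where
  carrier := {p | ∀ i, (fun x => p x i) ∈ P}
  zero_mem' := fun _ => P.zero_mem
  add_mem' := fun hp hq i => P.add_mem (hp i) (hq i)
  smul_mem' := fun r _ hp i => P.smul_mem r (hp i)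

/-- Lowest-order Raviart–Thomas space on simplices: `q + a x` with `a ∈ ℝ`. -/
def RT0Simplex (d : ℕ) : Submodule ℝ (Euc d → Euc d) where
  carrier := {p | ∃ (q : Euc d) (a : ℝ), ∀ x, p x = q + a • x}
  zero_mem' := ⟨0, 0, fun _ => by simp⟩
  add_mem' := by
    rintro v w ⟨q, a, h⟩ ⟨q', a', h'⟩
    exact ⟨q + q', a + a', fun x => by simp only [Pi.add_apply, h, h', add_smul]; abel⟩
  smul_mem' := by
    rintro r v ⟨q, a, h⟩
    exact ⟨r • q, r * a, fun x => by simp [h, smul_smul]⟩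

/-- Lowest-order Raviart–Thomas space on `d`-rectangles: `q + (a_1 x_1, …, a_d x_d)`. -/
def RT0Rect (d : ℕ) : Submodule ℝ (Euc d → Euc d) where
  carrier := {p | ∃ q a : Fin d → ℝ, ∀ x i, p x i = q i + a i * x i}
  zero_mem' := ⟨0, 0, fun _ _ => by simp⟩
  add_mem' := by
    rintro v w ⟨q, a, h⟩ ⟨q', a', h'⟩
    exact ⟨q + q', a + a', fun x i => by simp [h, h']; ring⟩
  smul_mem' := by
    rintro r v ⟨q, a, h⟩
    exact ⟨fun i => r * q i, fun i => r * a i, fun x i => by simp [h]; ring⟩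

/-- Divergence of a vector field on `ℝ^d`. -/
def divergence {d : ℕ} (p : Euc d → Euc d) (x : Euc d) : ℝ :=
  ∑ i, (fderiv ℝ p x (EuclideanSpace.single i 1)) i

/-! ### Data and the HDG method

Functions on a hyperedge are given in its local coordinates, functions on a hypernode as functions
on the ambient space `ℝ^D` (only their values on the hypernode matter). -/

variable {d D : ℕ} {ι ν : Type*} (G : PolyhedralHypergraph d D ι ν)

/-- `κ ∈ L^∞` with `κ ≥ κ₀ > 0` almost everywhere. -/
def IsDiffusionCoefficient (κ : ι → Euc d → ℝ) : Prop :=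
  (∀ e, MemLp (κ e) ⊤ (volume.restrict (G.dom e))) ∧
  ∃ κ₀ > 0, ∀ e, ∀ᵐ x ∂(volume.restrict (G.dom e)), κ₀ ≤ κ e x

/-- The standing assumptions: `G` is connected, the Dirichlet part `ΓD` of the boundary consists
of a positive number of boundary hypernodes, `0 ≤ f ∈ L²`, and the discrete Dirichlet datum
`g` is nonnegative with `g|_N ∈ M(N)`. -/
structure IsAdmissible (M : ν → Submodule ℝ (Euc D → ℝ)) (ΓD : Set ν)
    (f : ι → Euc d → ℝ) (g : ν → Euc D → ℝ) : Prop where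
  connected : G.Connected
  dirichlet_nonempty : ΓD.Nonempty
  dirichlet_boundary : ∀ n ∈ ΓD, G.IsBoundaryNode n
  memLp_source : ∀ e, MemLp (f e) 2 (volume.restrict (G.dom e))
  source_nonneg : ∀ e, ∀ᵐ x ∂(volume.restrict (G.dom e)), 0 ≤ f e x
  datum_mem : ∀ n ∈ ΓD, g n ∈ M n
  datum_nonneg : ∀ n ∈ ΓD, ∀ x ∈ G.node n, 0 ≤ g n x

/-- `(u, q, l)` (with `l` standing for `λ_h`) is a solution of the HDG method with local spaces
`U`, `Q`, `M`, stabilization parameters `τ`, diffusion coefficient `κ`, source `f`, Dirichlet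
boundary `ΓD` and Dirichlet datum `g`. -/
structure IsHDGSolution [Fintype ι] [Fintype ν]
    (U : ι → Submodule ℝ (Euc d → ℝ)) (Q : ι → Submodule ℝ (Euc d → Euc d))
    (M : ν → Submodule ℝ (Euc D → ℝ)) (τ : ι → ℝ) (κ f : ι → Euc d → ℝ)
    (ΓD : Set ν) (g : ν → Euc D → ℝ)
    (u : ι → Euc d → ℝ) (q : ι → Euc d → Euc d) (l : ν → Euc D → ℝ) : Prop where
  u_mem : ∀ e, u e ∈ U e
  q_mem : ∀ e, q e ∈ Q e
  l_mem : ∀ n, l n ∈ M n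
  dirichlet : ∀ n ∈ ΓD, ∀ x ∈ G.node n, l n x = g n x
  primary : ∀ e, ∀ p ∈ Q e,
    (∫ x in G.dom e, (κ e x)⁻¹ * ⟪q e x, p x⟫) - (∫ x in G.dom e, u e x * divergence p x) =
      - G.bdryIntegral e fun n x => l n (G.chart e x) * ⟪p x, G.normal e n⟫
  flux : ∀ e, ∀ v ∈ U e,
    (∫ x in G.dom e, v x * divergence (q e) x) +
        τ e * G.bdryIntegral e (fun _ x => u e x * v x) =
      τ e * G.bdryIntegral e (fun n x => l n (G.chart e x) * v x) + ∫ x in G.dom e, f e x * v x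
  conservation : ∀ m : ν → Euc D → ℝ, (∀ n, m n ∈ M n) → (∀ n ∈ ΓD, ∀ x ∈ G.node n, m n x = 0) →
    ∑ e, G.bdryIntegral e (fun n x => m n (G.chart e x) *
      (⟪q e x, G.normal e n⟫ + τ e * (u e x - l n (G.chart e x)))) = 0

/-- `u_h ≥ 0`. -/
def BulkNonneg (u : ι → Euc d → ℝ) : Prop := ∀ e, ∀ x ∈ G.dom e, 0 ≤ u e x

/-- `λ_h ≥ 0`. -/
def SkeletonNonneg (l : ν → Euc D → ℝ) : Prop := ∀ n, ∀ x ∈ G.node n, 0 ≤ l n x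

/-- The angle between any two distinct faces of the hyperedge `e` is not obtuse. -/
def NonobtuseAt (e : ι) : Prop :=
  ∀ n n', n ≠ n' → G.Incident e n → G.Incident e n' → ⟪G.normal e n, G.normal e n'⟫ ≤ 0

/-- Aspect ratio of a rectangle with side lengths `s` and `t`. -/
def aspectRatio (s t : ℝ) : ℝ := max s t / min s t

end HDG

end

noncomputable section

namespace HDG

/-! ### Flat polytopes, faces and normals -/

namespace IsFlatPolytope

variable {D k : ℕ} {S : Set (Euc D)}

/-! Since `M(N)` consists of constants, `λ_h` is a vector `lam` indexed by hypernodes, and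
everything rests on a discrete maximum principle for it. The negative part `m = max (-lam) 0`
vanishes on the Dirichlet boundary because the datum is nonnegative there, so it is an admissible
test function in the conservation equation. The result is that the sum over all hyperedges of the
local quantities `∑ m n * Φ n` is zero, where `Φ n` is the integral of the numerical flux over the
face `n`.

If each local sum is nonnegative, then each is zero. If, moreover, a zero sum forces all hypernodes
of the hyperedge to be nonnegative as soon as one of them is, then nonnegativity spreads from a
Dirichlet hypernode along chains of hyperedges to all of the connected hypergraph. These two local
properties are `LocalMonotone`, and the global argument is `IsHDGSolution.nonneg_of_localMonotone`.
Once `lam ≥ 0` is known, the local equations give the sign of `u_h`.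

What remains is to solve the local problems for `Φ` in terms of `lam`. The result always has the
form `Φ = r - B lam`, with `r ≥ 0` coming from the source and `B` symmetric, positive semidefinite
and with nonpositive off-diagonal entries. For LDG-H and for Raviart–Thomas on simplices,
`localMonotone_of_matrix` applies: `B` contains the Gram matrix of the area-weighted normals, whose
signs are controlled by the angle condition or, for LDG-H, by a large `τ`. On edges and rectangles,
`Φ` is a nonnegative combination of differences of `lam`, as in an electrical network, and
`sq_negPart_sub_le` is applied to each difference (`IsEdge.localMonotone`, `IsRect.localMonotone`).
The lower bound on `τ` for rectangles says exactly that the conductance between opposite sides is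
nonnegative.

The geometric input is `IsOutwardNormal.exists_support`: for a convex hyperedge, the local
description of the normal yields a global supporting half-space. This identifies the normals of
edges, simplices and rectangles. -/

theorem isCompact (h : IsFlatPolytope k S) : IsCompact S := by
  obtain ⟨⟨T, rfl⟩, -, -⟩ := h
  exact T.isCompact_biUnion fun t _ => t.finite_toSet.isCompact_convexHull ℝ

theorem nonempty (h : IsFlatPolytope k S) : S.Nonempty := by
  by_contra hS
  have := h.2.2
  rw [not_nonempty_iff_eq_empty.1 hS] at this
  simp at this

/-- Inside the supporting affine subspace, `μHE[k]` is Lebesgue measure after a choice of origin,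
and compact sets have finite Lebesgue measure. -/
theorem measure_lt_top (h : IsFlatPolytope k S) : μHE[k] S < ⊤ := by
  obtain ⟨A, rfl, hSA⟩ := h.2.1
  obtain ⟨p, hp⟩ := h.nonempty
  have : Nonempty A := ⟨⟨p, hSA hp⟩⟩
  have himg : S = Subtype.val '' ((↑) ⁻¹' S : Set A) := by
    refine (image_preimage_eq_of_subset ?_).symm
    rw [Subtype.range_coe]
    exact hSA
  have hcpt : IsCompact ((↑) ⁻¹' S : Set A) := by
    refine Topology.IsClosedEmbedding.isCompact_preimage ?_ h.isCompact
    exact (AffineSubspace.closed_of_finiteDimensional A).isClosedEmbedding_subtypeVal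
  rw [himg, AffineSubspace.euclideanHausdorffMeasure_coe_image,
    EuclideanGeometry.euclideanHausdorffMeasure_eq (⟨p, hSA hp⟩ : A)]
  rw [Measure.map_apply (by fun_prop) hcpt.measurableSet]
  have := (IsometryEquiv.vaddConst (⟨p, hSA hp⟩ : A)).toHomeomorph.isClosedEmbedding.isCompact_preimage
    hcpt
  exact this.measure_lt_top

theorem subsingleton (h : IsFlatPolytope 0 S) : S.Subsingleton := by
  obtain ⟨A, hA, hSA⟩ := h.2.1
  intro x hx y hy
  have hbot : A.direction = ⊥ := Submodule.finrank_eq_zero.1 hA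
  have := AffineSubspace.vsub_mem_direction (hSA hx) (hSA hy)
  rw [hbot, Submodule.mem_bot] at this
  exact vsub_eq_zero_iff_eq.1 this

end IsFlatPolytope

/-! ### Supporting half-spaces at convex faces -/

theorem exists_small_mul_lt {c r : ℝ} (hc : 0 ≤ c) (hr : 0 < r) :
    ∃ t : ℝ, 0 < t ∧ t < 1 ∧ t * c < r := by
  have hpos : 0 < c + 1 := by positivity
  refine ⟨min (1 / 2) (r / (2 * (c + 1))), by positivity,
    (min_le_left _ _).trans_lt (by norm_num), ?_⟩
  calc min (1 / 2) (r / (2 * (c + 1))) * c ≤ (r / (2 * (c + 1))) * (c + 1) := by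
        gcongr
        · exact min_le_right _ _
        · linarith
    _ = r / 2 := by field_simp
    _ < r := by linarith

/-- A convex open set lies in the half-space given by the outward normal on a convex part of its
boundary. -/
theorem IsOutwardNormal.exists_support {d : ℕ} {E F : Set (Euc d)} {w : Euc d}
    (h : IsOutwardNormal E F w) (hEo : IsOpen E) (hE : Convex ℝ E) (hF : Convex ℝ F)
    (hFE : F ⊆ frontier E) (hpos : 0 < μHE[d - 1] F) :
    ∃ x₀ ∈ F, (∀ y ∈ F, ⟪y - x₀, w⟫ = 0) ∧ ∀ y ∈ E, ⟪y - x₀, w⟫ < 0 := by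
  -- The half-space description holds almost everywhere on `F`, and `F` has positive measure, so it
  -- holds at some point of `F`.
  obtain ⟨x₀, hx₀, r, hr, hball⟩ : ∃ x ∈ F, ∃ r > 0, ∀ y ∈ Metric.ball x r, y ∈ E ↔ ⟪y - x, w⟫ < 0 := by
    by_contra! hcon
    have h2 := h.2
    have : ∀ᵐ x ∂(μHE[d - 1].restrict F), x ∉ F := by
      filter_upwards [h2] with x hx hxF
      obtain ⟨r, hr, hx⟩ := hx
      obtain ⟨y, hy, hy'⟩ := hcon x hxF r hr
      rcases hy' with ⟨hyE, hy'⟩ | ⟨hyE, hy'⟩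
      · exact hy'.not_gt ((hx y hy).1 hyE)
      · exact hyE ((hx y hy).2 hy')
    rw [ae_iff] at this
    simp only [not_not] at this
    have h3 : μHE[d - 1].restrict F {a | a ∈ F} = μHE[d - 1] F := by
      simp
    rw [h3] at this
    exact hpos.ne' this
  have hlt : ∀ y ∈ E, ⟪y - x₀, w⟫ < 0 := by
    intro y hy
    obtain ⟨t, ht0, ht1, htr⟩ := exists_small_mul_lt (norm_nonneg (y - x₀)) hr
    -- The open segment from a boundary point to an interior point stays in the convex open set.
    -- Shrinking `y` towards `x₀` reaches the ball without changing the sign of the inner product.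
    have hmem : x₀ + t • (y - x₀) ∈ E := by
      have := hE.openSegment_closure_interior_subset_interior (frontier_subset_closure (hFE hx₀))
        (by rwa [hEo.interior_eq] : y ∈ interior E)
      rw [hEo.interior_eq] at this
      refine this ⟨1 - t, t, by linarith, ht0, by ring, ?_⟩
      module
    have hb : x₀ + t • (y - x₀) ∈ Metric.ball x₀ r := by
      rw [Metric.mem_ball, dist_eq_norm, add_sub_cancel_left, norm_smul, Real.norm_of_nonneg ht0.le]
      exact htr
    have := (hball _ hb).1 hmem
    rw [add_sub_cancel_left, real_inner_smul_left] at this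
    by_contra hcon
    push Not at hcon
    nlinarith [mul_nonneg ht0.le hcon]
  have hle : ∀ y ∈ closure E, ⟪y - x₀, w⟫ ≤ 0 := by
    intro y hy
    have hcl : IsClosed {y : Euc d | ⟪y - x₀, w⟫ ≤ 0} :=
      isClosed_le (by fun_prop) continuous_const
    exact closure_minimal (fun z hz => (hlt z hz).le) hcl hy
  refine ⟨x₀, hx₀, fun y hy => le_antisymm (hle y (frontier_subset_closure (hFE hy))) ?_, hlt⟩
  obtain ⟨t, ht0, ht1, htr⟩ := exists_small_mul_lt (norm_nonneg (y - x₀)) hr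
  have hmem : x₀ + t • (y - x₀) ∈ F :=
    hF.segment_subset hx₀ hy ⟨1 - t, t, by linarith, ht0.le, by ring, by module⟩
  have hb : x₀ + t • (y - x₀) ∈ Metric.ball x₀ r := by
    rw [Metric.mem_ball, dist_eq_norm, add_sub_cancel_left, norm_smul, Real.norm_of_nonneg ht0.le]
    exact htr
  -- Boundary points are not in the open set `E`, so the local description at `x₀` gives the
  -- inequality opposite to `hle`.
  have hnot : x₀ + t • (y - x₀) ∉ E := by
    have := hFE hmem
    rw [hEo.frontier_eq] at this
    exact this.2
  have := (hball _ hb).not.1 hnot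
  rw [add_sub_cancel_left, real_inner_smul_left] at this
  push Not at this
  by_contra hcon
  push Not at hcon
  nlinarith [mul_pos ht0 (neg_pos.2 hcon)]

/-! ### Measure and incidence of faces in local coordinates -/

namespace PolyhedralHypergraph

variable {d D : ℕ} {ι ν : Type*} (G : PolyhedralHypergraph d D ι ν)

/-- The surface measure of a face of the hyperedge `e`. -/
def area (e : ι) (n : ν) : ℝ := (μHE[d - 1]).real (G.face e n)

variable {G}

theorem normal_spec {e : ι} {n : ν} (h : G.Incident e n) :
    IsOutwardNormal (G.dom e) (G.face e n) (G.normal e n) :=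
  Classical.epsilon_spec (G.exists_normal e n h)

theorem image_face {e : ι} {n : ν} (h : G.Incident e n) : G.chart e '' G.face e n = G.node n :=
  image_preimage_eq_of_subset (h.trans (image_subset_range _ _))

theorem face_subset_frontier {e : ι} {n : ν} (h : G.Incident e n) :
    G.face e n ⊆ frontier (G.dom e) := by
  intro x hx
  obtain ⟨y, hy, hyx⟩ := h hx
  rwa [← (G.chart e).injective hyx]

theorem measure_face {e : ι} {n : ν} (h : G.Incident e n) :
    μHE[d - 1] (G.face e n) = μHE[d - 1] (G.node n) := by
  rw [← image_face h, (G.chart e).isometry.euclideanHausdorffMeasure_image]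

theorem measure_face_pos {e : ι} {n : ν} (h : G.Incident e n) : 0 < μHE[d - 1] (G.face e n) := by
  rw [measure_face h]
  exact (G.flat_node n).2.2

theorem measure_face_lt_top {e : ι} {n : ν} (h : G.Incident e n) :
    μHE[d - 1] (G.face e n) < ⊤ := by
  rw [measure_face h]
  exact (G.flat_node n).measure_lt_top

theorem area_pos {e : ι} {n : ν} (h : G.Incident e n) : 0 < G.area e n :=
  ENNReal.toReal_pos (measure_face_pos h).ne' (measure_face_lt_top h).ne

theorem measurableSet_face (e : ι) (n : ν) : MeasurableSet (G.face e n) :=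
  ((G.flat_node n).isCompact.isClosed.preimage (G.chart e).continuous).measurableSet

theorem face_nonempty {e : ι} {n : ν} (h : G.Incident e n) : (G.face e n).Nonempty := by
  rw [← image_nonempty (f := G.chart e), image_face h]
  exact (G.flat_node n).nonempty

/-- Distinct hypernodes overlap in a null set, whereas a common face would have positive measure. -/
theorem eq_of_face_eq {e : ι} {n n' : ν} (h : G.Incident e n) (h' : G.Incident e n')
    (hf : G.face e n = G.face e n') : n = n' := by
  by_contra hne
  have h0 := G.inter_null n n' hne
  rw [← image_face h, ← image_face h', ← hf, inter_self, image_face h] at h0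
  exact (G.flat_node n).2.2.ne' h0

theorem exists_incident_mem {e : ι} {x : Euc d} (hx : x ∈ frontier (G.dom e)) :
    ∃ n, G.Incident e n ∧ x ∈ G.face e n := by
  have : G.chart e x ∈ G.chart e '' frontier (G.dom e) := mem_image_of_mem _ hx
  rw [G.boundary_eq e] at this
  simp only [mem_iUnion] at this
  obtain ⟨n, hn, hxn⟩ := this
  exact ⟨n, hn, hxn⟩

/-- A hyperedge with empty frontier would be clopen, hence empty or the whole space, which is
unbounded because the dimension is positive. -/
theorem exists_incident (hd : d ≠ 0) (e : ι) : ∃ n, G.Incident e n := by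
  have : Nonempty (Fin d) := ⟨⟨0, Nat.pos_of_ne_zero hd⟩⟩
  have : Nontrivial (Euc d) := inferInstance
  have hne : (frontier (G.dom e)).Nonempty := by
    by_contra hemp
    have hclopen : IsClopen (G.dom e) :=
      isClopen_iff_frontier_eq_empty.2 (not_nonempty_iff_eq_empty.1 hemp)
    rcases isClopen_iff.1 hclopen with h0 | h0
    · exact (G.isConnected_dom e).nonempty.ne_empty h0
    · have := G.isBounded_dom e
      rw [h0] at this
      exact NormedSpace.unbounded_univ ℝ (Euc d) this
  obtain ⟨x, hx⟩ := hne
  obtain ⟨n, hn, -⟩ := exists_incident_mem hx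
  exact ⟨n, hn⟩

theorem volume_dom_pos (e : ι) : 0 < (volume : Measure (Euc d)).real (G.dom e) :=
  ENNReal.toReal_pos ((G.isOpen_dom e).measure_pos _ (G.isConnected_dom e).nonempty).ne'
    (G.isBounded_dom e).measure_lt_top.ne

theorem integrableOn_dom {F : Type*} [NormedAddCommGroup F] {φ : Euc d → F} (hφ : Continuous φ)
    (e : ι) : IntegrableOn φ (G.dom e) :=
  (hφ.continuousOn.integrableOn_compact (G.isBounded_dom e).isCompact_closure).mono_set
    subset_closure

theorem setIntegral_face_eq {e : ι} {n : ν} {φ : Euc d → ℝ} {c : ℝ}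
    (h : ∀ x ∈ G.face e n, φ x = c) : ∫ x in G.face e n, φ x ∂μHE[d - 1] = G.area e n * c := by
  rw [setIntegral_congr_fun (measurableSet_face e n) h, setIntegral_const, smul_eq_mul, area]

end PolyhedralHypergraph

theorem exists_eq_const {D : ℕ} {ν : Type*} {l : ν → Euc D → ℝ} (h : ∀ n, l n ∈ P0 (Euc D)) :
    ∃ lam : ν → ℝ, l = fun n _ => lam n := by
  choose lam hlam using h
  exact ⟨lam, funext fun n => funext fun x => hlam n x⟩

open PolyhedralHypergraph

variable {d D : ℕ} {ι ν : Type*} [Fintype ν] {G : PolyhedralHypergraph d D ι ν}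

/-! ### Local problems and the discrete maximum principle -/

open Classical in
/-- The hypernodes in the boundary of a hyperedge. -/
def nodesOf (G : PolyhedralHypergraph d D ι ν) (e : ι) : Finset ν :=
  Finset.univ.filter (G.Incident e)

@[simp]
theorem mem_nodesOf {e : ι} {n : ν} : n ∈ nodesOf G e ↔ G.Incident e n := by
  simp [nodesOf]

theorem bdryIntegral_eq (e : ι) (F : ν → Euc d → ℝ) :
    G.bdryIntegral e F = ∑ n ∈ nodesOf G e, ∫ x in G.face e n, F n x ∂μHE[d - 1] := rfl

variable (G) in
/-- The equations of the HDG method on the hyperedge `e` for given constant values `lam` of the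
skeletal unknown. -/
structure LocalSolution (e : ι) (U : Submodule ℝ (Euc d → ℝ)) (Q : Submodule ℝ (Euc d → Euc d))
    (τ : ℝ) (κ f u : Euc d → ℝ) (q : Euc d → Euc d) (lam : ν → ℝ) : Prop where
  u_mem : u ∈ U
  q_mem : q ∈ Q
  primary : ∀ p ∈ Q,
    (∫ x in G.dom e, (κ x)⁻¹ * ⟪q x, p x⟫) - (∫ x in G.dom e, u x * divergence p x) =
      - ∑ n ∈ nodesOf G e, lam n * ∫ x in G.face e n, ⟪p x, G.normal e n⟫ ∂μHE[d - 1]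
  flux : ∀ v ∈ U,
    (∫ x in G.dom e, v x * divergence q x) +
        τ * ∑ n ∈ nodesOf G e, ∫ x in G.face e n, u x * v x ∂μHE[d - 1] =
      τ * ∑ n ∈ nodesOf G e, lam n * ∫ x in G.face e n, v x ∂μHE[d - 1] +
        ∫ x in G.dom e, f x * v x

variable (G) in
/-- The integral of the numerical flux over a face. -/
def numFlux (e : ι) (τ : ℝ) (u : Euc d → ℝ) (q : Euc d → Euc d) (lam : ν → ℝ) (n : ν) : ℝ :=
  ∫ x in G.face e n, (⟪q x, G.normal e n⟫ + τ * (u x - lam n)) ∂μHE[d - 1]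

variable (G) in
/-- Testing the numerical flux of a hyperedge with the negative part of `lam` is monotone, and
degenerate only if the negativity of `lam` is the same at all hypernodes of the hyperedge. -/
def LocalMonotone (e : ι) (lam Φ : ν → ℝ) : Prop :=
  0 ≤ ∑ n ∈ nodesOf G e, max (-lam n) 0 * Φ n ∧
    (∑ n ∈ nodesOf G e, max (-lam n) 0 * Φ n = 0 →
      ∀ n₀, G.Incident e n₀ → 0 ≤ lam n₀ → ∀ n, G.Incident e n → 0 ≤ lam n)

/-- The monotonicity criterion for local matrices with nonpositive off-diagonal entries. -/
theorem localMonotone_of_matrix {e : ι} {lam Φ r : ν → ℝ} {B : ν → ν → ℝ}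
    (hΦ : ∀ n, G.Incident e n → Φ n = r n - ∑ n' ∈ nodesOf G e, B n n' * lam n')
    (hr : ∀ n, G.Incident e n → 0 ≤ r n)
    (hB : ∀ n n', G.Incident e n → G.Incident e n' → n ≠ n' → B n n' ≤ 0)
    (hpos : ∀ m : ν → ℝ, 0 ≤ ∑ n ∈ nodesOf G e, ∑ n' ∈ nodesOf G e, m n * (B n n' * m n'))
    (hker : ∀ m : ν → ℝ, (∀ n, 0 ≤ m n) →
      ∑ n ∈ nodesOf G e, ∑ n' ∈ nodesOf G e, m n * (B n n' * m n') = 0 →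
      ∀ n₀, G.Incident e n₀ → m n₀ = 0 → ∀ n, G.Incident e n → m n = 0) :
    LocalMonotone G e lam Φ := by
  set m : ν → ℝ := fun n => max (-lam n) 0 with hm
  have hmn : ∀ n, 0 ≤ m n := fun n => le_max_right _ _
  -- Here `m + lam` is the positive part of `lam`. Replacing `-lam` by `m` changes nothing on the
  -- diagonal, where positive and negative part multiply to zero, and does not increase the sum off
  -- the diagonal, where `B ≤ 0`.
  have key : ∑ n ∈ nodesOf G e, ∑ n' ∈ nodesOf G e, m n * (B n n' * m n') ≤
      ∑ n ∈ nodesOf G e, m n * Φ n := by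
    refine Finset.sum_le_sum fun n hn => ?_
    rw [mem_nodesOf] at hn
    rw [hΦ n hn, mul_sub, Finset.mul_sum]
    have h1 : 0 ≤ m n * r n := mul_nonneg (hmn n) (hr n hn)
    suffices ∑ n' ∈ nodesOf G e, m n * (B n n' * m n') ≤
        -∑ n' ∈ nodesOf G e, m n * (B n n' * lam n') by linarith
    rw [← Finset.sum_neg_distrib]
    refine Finset.sum_le_sum fun n' hn' => ?_
    rw [mem_nodesOf] at hn'
    have hp : 0 ≤ m n' + lam n' := by
      have := le_max_left (-lam n') 0
      simp only [hm]; linarith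
    by_cases hne : n = n'
    · subst hne
      have : m n * (m n + lam n) = 0 := by
        simp only [hm]
        rcases le_total 0 (lam n) with h0 | h0
        · simp [max_eq_right (neg_nonpos.2 h0)]
        · simp [max_eq_left (neg_nonneg.2 h0)]
      nlinarith [congrArg (fun z => B n n * z) this]
    · have h2 := mul_nonneg (mul_nonneg (hmn n) (neg_nonneg.2 (hB n n' hn hn' hne))) hp
      nlinarith
  refine ⟨(hpos m).trans key, fun h0 n₀ hn₀ hl₀ n hn => ?_⟩
  have := hker m hmn (le_antisymm (h0 ▸ key) (hpos m)) n₀ hn₀ (by simpa [hm] using hl₀) n hn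
  simpa [hm] using this

variable [Fintype ι]
variable {U : ι → Submodule ℝ (Euc d → ℝ)} {Q : ι → Submodule ℝ (Euc d → Euc d)}
  {M : ν → Submodule ℝ (Euc D → ℝ)}
  {τ : ι → ℝ} {κ f : ι → Euc d → ℝ} {ΓD : Set ν} {g : ν → Euc D → ℝ} {u : ι → Euc d → ℝ}
  {q : ι → Euc d → Euc d} {lam : ν → ℝ}

theorem IsHDGSolution.localSolution
    (h : IsHDGSolution G U Q M τ κ f ΓD g u q fun n _ => lam n) (e : ι) :
    LocalSolution G e (U e) (Q e) (τ e) (κ e) (f e) (u e) (q e) lam where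
  u_mem := h.u_mem e
  q_mem := h.q_mem e
  primary p hp := by
    simpa only [bdryIntegral_eq, integral_const_mul] using h.primary e p hp
  flux v hv := by
    simpa only [bdryIntegral_eq, integral_const_mul] using h.flux e v hv

/-- The conservation equation tested with the negative part makes a sum of nonnegative local terms
vanish, so each hyperedge is in the degenerate case. There the sign passes from one hypernode to all
others, starting from a Dirichlet hypernode. -/
theorem IsHDGSolution.nonneg_of_localMonotone
    (hadm : IsAdmissible G (fun _ => P0 (Euc D)) ΓD f g)
    (h : IsHDGSolution G U Q (fun _ => P0 (Euc D)) τ κ f ΓD g u q fun n _ => lam n)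
    (hloc : ∀ e, LocalMonotone G e lam (numFlux G e (τ e) (u e) (q e) lam)) (n : ν) :
    0 ≤ lam n := by
  have hD : ∀ n ∈ ΓD, 0 ≤ lam n := by
    intro n hn
    obtain ⟨x, hx⟩ := (G.flat_node n).nonempty
    have := h.dirichlet n hn x hx
    rw [this]
    exact hadm.datum_nonneg n hn x hx
  have hcons := h.conservation (fun n _ => max (-lam n) 0) (fun n => ⟨_, fun _ => rfl⟩)
    (fun n hn x _ => by simpa using hD n hn)
  simp only [bdryIntegral_eq, integral_const_mul] at hcons
  have hzero := (Finset.sum_eq_zero_iff_of_nonneg (fun e _ => (hloc e).1)).1 hcons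
  obtain ⟨n₀, hn₀⟩ := hadm.dirichlet_nonempty
  obtain ⟨e₀, he₀, -⟩ := hadm.dirichlet_boundary n₀ hn₀
  obtain ⟨e, he⟩ := G.node_subset n
  -- Induction along the chain: a shared hypernode, known to be nonnegative from the previous
  -- hyperedge, is the seed for the next one.
  have hall : ∀ b, Relation.ReflTransGen
      (fun a b => ∃ n, G.Incident a n ∧ G.Incident b n) e₀ b → ∀ n, G.Incident b n → 0 ≤ lam n := by
    intro b hb
    induction hb with
    | refl => exact (hloc e₀).2 (hzero e₀ (Finset.mem_univ _)) n₀ he₀ (hD n₀ hn₀)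
    | @tail a b _ hab ih =>
      obtain ⟨n', hna, hnb⟩ := hab
      exact (hloc b).2 (hzero b (Finset.mem_univ _)) n' hnb (ih n' hna)
  exact hall e (hadm.connected e₀ e) n he

end HDG

end

noncomputable section

namespace HDG

open PolyhedralHypergraph

/-! ### Lowest-order local problems on general hyperedges -/

theorem divergence_eq_of_hasFDerivAt {d : ℕ} {p : Euc d → Euc d} {x : Euc d}
    {L : Fin d → (Euc d →L[ℝ] ℝ)} (h : ∀ i, HasFDerivAt (fun y => p y i) (L i) x) :
    divergence p x = ∑ i, L i (EuclideanSpace.single i 1) := by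
  have hd : DifferentiableAt ℝ p x :=
    differentiableAt_euclidean.2 fun i => (h i).differentiableAt
  refine Finset.sum_congr rfl fun i _ => ?_
  have := ((EuclideanSpace.proj i : Euc d →L[ℝ] ℝ).hasFDerivAt.comp x hd.hasFDerivAt).unique (h i)
  rw [← this]
  rfl

theorem divergence_const {d : ℕ} (c x : Euc d) : divergence (fun _ => c) x = 0 := by
  simp [divergence]

theorem divergence_affine {d : ℕ} (c x : Euc d) (a : ℝ) :
    divergence (fun y => c + a • y) x = a * d := by
  have h : HasFDerivAt (fun y : Euc d => c + a • y) (a • ContinuousLinearMap.id ℝ (Euc d)) x :=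
    ((hasFDerivAt_id x).const_smul a).const_add c
  simp [divergence, h.fderiv, mul_comm]

theorem mem_vec_P0 {d : ℕ} {p : Euc d → Euc d} : p ∈ vec (P0 (Euc d)) ↔ ∃ c, ∀ x, p x = c := by
  constructor
  · intro h
    choose c hc using h
    exact ⟨WithLp.toLp 2 c, fun x => PiLp.ext fun i => hc i x⟩
  · rintro ⟨c, hc⟩ i
    exact ⟨c i, fun x => congrArg (· i) (hc x)⟩

variable {d D : ℕ} {ι ν : Type*} {G : PolyhedralHypergraph d D ι ν}

theorem norm_normal {e : ι} {n : ν} (h : G.Incident e n) : ‖G.normal e n‖ = 1 :=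
  (normal_spec h).1

/-- The Gram matrix of the weighted normals is positive semidefinite; its kernel consists of the
linear relations between them. -/
theorem area_mul_matrix_sum (s : Finset ν) (a m : ν → ℝ) (w : ν → Euc d) :
    ∑ n ∈ s, ∑ n' ∈ s, m n * (a n * a n' * ⟪w n, w n'⟫ * m n') = ‖∑ n ∈ s, (m n * a n) • w n‖ ^ 2 := by
  rw [← real_inner_self_eq_norm_sq, sum_inner]
  refine Finset.sum_congr rfl fun n _ => ?_
  rw [inner_sum]
  refine Finset.sum_congr rfl fun n' _ => ?_
  rw [real_inner_smul_left, real_inner_smul_right]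
  ring

/-- The lower bound on `κ` bounds `κ⁻¹` from above, so the integral exists. The integrand is
positive almost everywhere on a nonempty open set. -/
theorem integral_inv_pos {κ : Euc d → ℝ} {κ₀ : ℝ} {e : ι}
    (hκ : MemLp κ ⊤ (volume.restrict (G.dom e))) (hκ₀ : 0 < κ₀)
    (hle : ∀ᵐ x ∂(volume.restrict (G.dom e)), κ₀ ≤ κ x) :
    0 < ∫ x in G.dom e, (κ x)⁻¹ := by
  have hfin : IsFiniteMeasure (volume.restrict (G.dom e)) :=
    ⟨by rw [Measure.restrict_apply_univ]; exact (G.isBounded_dom e).measure_lt_top⟩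
  have hint : Integrable (fun x => (κ x)⁻¹) (volume.restrict (G.dom e)) := by
    refine Integrable.of_bound (C := κ₀⁻¹) ?_ ?_
    · exact hκ.1.aemeasurable.inv.aestronglyMeasurable
    · filter_upwards [hle] with x hx
      rw [Real.norm_of_nonneg (inv_nonneg.2 (hκ₀.le.trans hx))]
      exact inv_anti₀ hκ₀ hx
  rw [integral_pos_iff_support_of_nonneg_ae _ hint]
  · have hsupp : ∀ᵐ x ∂(volume.restrict (G.dom e)), x ∈ Function.support fun x => (κ x)⁻¹ := by
      filter_upwards [hle] with x hx
      exact (inv_pos.2 (hκ₀.trans_le hx)).ne'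
    rw [measure_eq_measure_of_null_sdiff (subset_univ _) (by rwa [← compl_eq_univ_sdiff]),
      Measure.restrict_apply_univ]
    exact (G.isOpen_dom e).measure_pos _ (G.isConnected_dom e).nonempty
  · filter_upwards [hle] with x hx
    exact inv_nonneg.2 (hκ₀.le.trans hx)

variable [Fintype ν]

theorem sum_area_pos (hd : d ≠ 0) (e : ι) : 0 < ∑ n ∈ nodesOf G e, G.area e n := by
  obtain ⟨n, hn⟩ := G.exists_incident hd e
  exact Finset.sum_pos (fun n hn => area_pos (mem_nodesOf.1 hn)) ⟨n, mem_nodesOf.2 hn⟩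

/-! ### Elimination of the LDG-H unknowns -/

section LDG

variable {e : ι} {τ : ℝ} {κ f u : Euc d → ℝ} {q : Euc d → Euc d} {lam : ν → ℝ}

/-- The local problem for piecewise constant unknowns. -/
theorem LocalSolution.const_const
    (h : LocalSolution G e (P0 (Euc d)) (vec (P0 (Euc d))) τ κ f u q lam) :
    ∃ (u₀ : ℝ) (q₀ : Euc d), (∀ x, u x = u₀) ∧ (∀ x, q x = q₀) ∧
      (∀ w, (∫ x in G.dom e, (κ x)⁻¹) * ⟪q₀, w⟫ =
        -∑ n ∈ nodesOf G e, lam n * (G.area e n * ⟪w, G.normal e n⟫)) ∧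
      τ * (∑ n ∈ nodesOf G e, G.area e n) * u₀ =
        τ * (∑ n ∈ nodesOf G e, lam n * G.area e n) + ∫ x in G.dom e, f x := by
  obtain ⟨u₀, hu⟩ := h.u_mem
  obtain ⟨q₀, hq⟩ := mem_vec_P0.1 h.q_mem
  obtain rfl : u = fun _ => u₀ := funext hu
  obtain rfl : q = fun _ => q₀ := funext hq
  refine ⟨u₀, q₀, fun _ => rfl, fun _ => rfl, fun w => ?_, ?_⟩
  · have := h.primary (fun _ => w) (mem_vec_P0.2 ⟨w, fun _ => rfl⟩)
    simp only [divergence_const, mul_zero, integral_zero, sub_zero, integral_mul_const,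
      setIntegral_const, smul_eq_mul] at this
    exact this
  · have := h.flux (fun _ => 1) ⟨1, fun _ => rfl⟩
    simp only [divergence_const, mul_zero, integral_zero, zero_add, mul_one,
      setIntegral_const, smul_eq_mul, ← Finset.sum_mul] at this
    rw [mul_assoc]
    exact this

theorem LocalSolution.localMonotone_const_const (hd : d ≠ 0)
    (h : LocalSolution G e (P0 (Euc d)) (vec (P0 (Euc d))) τ κ f u q lam) (hτ : 0 < τ)
    (hK : 0 < ∫ x in G.dom e, (κ x)⁻¹) (hf : 0 ≤ ∫ x in G.dom e, f x)
    (hgeo : NonobtuseAt G e ∨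
      (∑ n ∈ nodesOf G e, G.area e n) / (∫ x in G.dom e, (κ x)⁻¹) ≤ τ) :
    LocalMonotone G e lam (numFlux G e τ u q lam) := by
  classical
  obtain ⟨u₀, q₀, hu, hq, hq₀, hu₀⟩ := h.const_const
  have hA := sum_area_pos (G := G) hd e
  set A := ∑ n ∈ nodesOf G e, G.area e n with hAdef
  set K := ∫ x in G.dom e, (κ x)⁻¹
  set F := ∫ x in G.dom e, f x
  let a := G.area e
  let w := G.normal e
  -- The first term comes from eliminating `q₀`, the second from eliminating `u₀`, and the diagonal
  -- term from `-τ * lam n` in the numerical flux.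
  let B : ν → ν → ℝ := fun n n' =>
    a n * a n' * ⟪w n, w n'⟫ / K - τ * (a n * a n') / A + if n = n' then τ * a n else 0
  -- The two stabilization terms combine to the weighted variance of `m` over the faces.
  have hBsum : ∀ m : ν → ℝ, ∑ n ∈ nodesOf G e, ∑ n' ∈ nodesOf G e, m n * (B n n' * m n') =
      ‖∑ n ∈ nodesOf G e, (m n * a n) • w n‖ ^ 2 / K +
        τ * ∑ n ∈ nodesOf G e, a n * (m n - (∑ n' ∈ nodesOf G e, m n' * a n') / A) ^ 2 := by
    intro m
    set S := ∑ n' ∈ nodesOf G e, m n' * a n' with hS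
    have h1 : ∀ n ∈ nodesOf G e, ∑ n' ∈ nodesOf G e, m n * (B n n' * m n') =
        (∑ n' ∈ nodesOf G e, m n * (a n * a n' * ⟪w n, w n'⟫ * m n')) / K -
          τ * (m n * a n) * S / A + τ * a n * m n ^ 2 := by
      intro n hn
      have : ∀ n', m n * (B n n' * m n') = m n * (a n * a n' * ⟪w n, w n'⟫ * m n') / K -
          τ * (m n * a n) / A * (m n' * a n') + if n = n' then τ * a n * m n ^ 2 else 0 := by
        intro n'
        by_cases hnn : n = n'
        · subst hnn; simp only [B, if_true]; ring
        · simp only [B, if_neg hnn]; ring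
      simp only [this, Finset.sum_add_distrib, Finset.sum_sub_distrib, ← Finset.mul_sum,
        ← Finset.sum_div, Finset.sum_ite_eq, if_pos hn, ← hS]
      ring
    rw [Finset.sum_congr rfl h1, Finset.sum_add_distrib, Finset.sum_sub_distrib, ← Finset.sum_div,
      area_mul_matrix_sum]
    have h2 : ∑ n ∈ nodesOf G e, τ * (m n * a n) * S / A = τ * S * S / A := by
      rw [← Finset.sum_div, ← Finset.sum_mul, ← Finset.mul_sum]
    have h3 : ∑ n ∈ nodesOf G e, a n * (m n - S / A) ^ 2 =
        ∑ n ∈ nodesOf G e, a n * m n ^ 2 - 2 * (S / A) * S + A * (S / A) ^ 2 := by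
      rw [hS, hAdef, Finset.mul_sum, Finset.sum_mul, ← hS, ← hAdef, ← Finset.sum_sub_distrib,
        ← Finset.sum_add_distrib]
      refine Finset.sum_congr rfl fun n _ => ?_
      simp only [a]; ring
    have h4 : ∑ n ∈ nodesOf G e, τ * a n * m n ^ 2 = τ * ∑ n ∈ nodesOf G e, a n * m n ^ 2 := by
      rw [Finset.mul_sum]
      exact Finset.sum_congr rfl fun n _ => by ring
    rw [h2, h3, h4]
    field_simp
    ring
  refine localMonotone_of_matrix (B := B) (r := fun n => a n * F / A) ?_ ?_ ?_ ?_ ?_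
  · intro n hn
    have hΦ : numFlux G e τ u q lam n = a n * (⟪q₀, w n⟫ + τ * (u₀ - lam n)) :=
      setIntegral_face_eq fun x _ => by rw [hu, hq]
    rw [hΦ]
    have h1 : ∑ n' ∈ nodesOf G e, B n n' * lam n' =
        a n * (∑ n' ∈ nodesOf G e, lam n' * (a n' * ⟪w n, w n'⟫)) / K -
          τ * a n * (∑ n' ∈ nodesOf G e, lam n' * a n') / A + τ * a n * lam n := by
      have : ∀ n', B n n' * lam n' = a n * (lam n' * (a n' * ⟪w n, w n'⟫)) / K -
          τ * a n / A * (lam n' * a n') + if n = n' then τ * a n * lam n else 0 := by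
        intro n'
        by_cases hnn : n = n'
        · subst hnn; simp only [B, if_true]; ring
        · simp only [B, if_neg hnn]; ring
      simp only [this, Finset.sum_add_distrib, Finset.sum_sub_distrib, ← Finset.mul_sum,
        ← Finset.sum_div, Finset.sum_ite_eq, if_pos (mem_nodesOf.2 hn)]
      ring
    have h2 := hq₀ (w n)
    have h3 : ∑ n' ∈ nodesOf G e, lam n' * (a n' * ⟪w n, w n'⟫) = -(K * ⟪q₀, w n⟫) := by
      rw [h2, neg_neg]
    have h4 : τ * (∑ n' ∈ nodesOf G e, lam n' * a n') = τ * A * u₀ - F := by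
      rw [hu₀]; ring
    rw [h1, h3, mul_right_comm τ (a n), h4]
    field_simp
    ring
  · intro n hn
    exact div_nonneg (mul_nonneg (area_pos hn).le hf) hA.le
  · intro n n' hn hn' hne
    have haa : 0 < a n * a n' := mul_pos (area_pos hn) (area_pos hn')
    -- This is the sign of the off-diagonal entries. Either the left side is nonpositive by the
    -- angle condition, or it is at most `1 / K` since the normals are unit vectors, and `A / K ≤
    -- τ`.
    have hle : ⟪w n, w n'⟫ / K ≤ τ / A := by
      rcases hgeo with hgeo | hgeo
      · exact (div_nonpos_of_nonpos_of_nonneg (hgeo n n' hne hn hn') hK.le).trans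
          (div_nonneg hτ.le hA.le)
      · have h1 : ⟪w n, w n'⟫ ≤ 1 := by
          have := real_inner_le_norm (w n) (w n')
          rwa [norm_normal hn, norm_normal hn', one_mul] at this
        rw [div_le_iff₀ hK] at hgeo
        rw [div_le_div_iff₀ hK hA]
        nlinarith
    simp only [B, if_neg hne]
    have := mul_le_mul_of_nonneg_left hle haa.le
    have e1 : a n * a n' * (⟪w n, w n'⟫ / K) = a n * a n' * ⟪w n, w n'⟫ / K := by ring
    have e2 : a n * a n' * (τ / A) = τ * (a n * a n') / A := by ring
    linarith
  · intro m
    rw [hBsum]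
    exact add_nonneg (by positivity) (mul_nonneg hτ.le
      (Finset.sum_nonneg fun n hn => mul_nonneg (area_pos (mem_nodesOf.1 hn)).le (sq_nonneg _)))
  · intro m _ h0 n₀ hn₀ hm₀ n hn
    rw [hBsum] at h0
    have hsum : 0 ≤ ∑ n ∈ nodesOf G e, a n * (m n - (∑ n' ∈ nodesOf G e, m n' * a n') / A) ^ 2 :=
      Finset.sum_nonneg fun n hn => mul_nonneg (area_pos (mem_nodesOf.1 hn)).le (sq_nonneg _)
    have h1 : 0 ≤ ‖∑ n ∈ nodesOf G e, (m n * a n) • w n‖ ^ 2 / K := by positivity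
    have h2 : ∑ n ∈ nodesOf G e, a n * (m n - (∑ n' ∈ nodesOf G e, m n' * a n') / A) ^ 2 = 0 := by
      refine le_antisymm ?_ hsum
      by_contra hcon
      push Not at hcon
      linarith [mul_pos hτ hcon]
    -- A vanishing variance makes `m` constant on the faces, so one zero forces all others.
    have h3 : ∀ n, G.Incident e n → m n = (∑ n' ∈ nodesOf G e, m n' * a n') / A := by
      intro n hn
      have := (Finset.sum_eq_zero_iff_of_nonneg fun n hn =>
        mul_nonneg (area_pos (mem_nodesOf.1 hn)).le (sq_nonneg _)).1 h2 n (mem_nodesOf.2 hn)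
      have := (mul_eq_zero.1 this).resolve_left (area_pos hn).ne'
      exact sub_eq_zero.1 (pow_eq_zero_iff two_ne_zero |>.1 this)
    rw [h3 n hn, ← h3 n₀ hn₀, hm₀]

/-- The flux equation makes `u₀` the area-weighted mean of `lam` plus a nonnegative source
contribution. -/
theorem LocalSolution.nonneg_const_const (hd : d ≠ 0)
    (h : LocalSolution G e (P0 (Euc d)) (vec (P0 (Euc d))) τ κ f u q lam) (hτ : 0 < τ)
    (hf : 0 ≤ ∫ x in G.dom e, f x) (hlam : ∀ n, 0 ≤ lam n) (x : Euc d) : 0 ≤ u x := by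
  obtain ⟨u₀, q₀, hu, hq, hq₀, hu₀⟩ := h.const_const
  rw [hu]
  have hA := sum_area_pos (G := G) hd e
  have h1 : 0 ≤ ∑ n ∈ nodesOf G e, lam n * G.area e n :=
    Finset.sum_nonneg fun n hn => mul_nonneg (hlam n) (area_pos (mem_nodesOf.1 hn)).le
  have h2 : 0 ≤ τ * (∑ n ∈ nodesOf G e, G.area e n) * u₀ := by
    rw [hu₀]; positivity
  exact nonneg_of_mul_nonneg_right h2 (by positivity)

end LDG

end HDG

end

noncomputable section

namespace HDG

open PolyhedralHypergraph

/-! ### Raviart–Thomas elements on simplices -/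

/-- The index `j n` is the vertex opposite to the face `n`, and `x n` is a point of that face. If
the opposite vertex were not strictly inside, all vertices and hence the whole simplex would lie in
the outer half-space. -/
theorem PolyhedralHypergraph.IsSimplex.exists_support {d D : ℕ} {ι ν : Type*}
    {G : PolyhedralHypergraph d D ι ν} {e : ι} (h : G.IsSimplex e) :
    ∃ (v : Fin (d + 1) → Euc d) (j : ν → Fin (d + 1)) (x : ν → Euc d), ∀ n, G.Incident e n →
      G.face e n = convexHull ℝ (v '' {j n}ᶜ) ∧
      (∀ y ∈ G.face e n, ⟪y - x n, G.normal e n⟫ = 0) ∧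
      (∀ y ∈ G.dom e, ⟪y - x n, G.normal e n⟫ < 0) ∧
      ⟪v (j n) - x n, G.normal e n⟫ < 0 := by
  obtain ⟨v, -, hdom, hfaces⟩ := h
  have hall : ∀ n, ∃ (j : Fin (d + 1)) (x : Euc d), G.Incident e n →
      G.face e n = convexHull ℝ (v '' {j}ᶜ) ∧
      (∀ y ∈ G.face e n, ⟪y - x, G.normal e n⟫ = 0) ∧
      (∀ y ∈ G.dom e, ⟪y - x, G.normal e n⟫ < 0) ∧
      ⟪v j - x, G.normal e n⟫ < 0 := by
    intro n
    by_cases hn : G.Incident e n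
    swap
    · exact ⟨0, 0, fun h => absurd h hn⟩
    have hmem : G.face e n ∈ G.faces e := ⟨n, hn, rfl⟩
    rw [hfaces] at hmem
    obtain ⟨j, hj⟩ := hmem
    obtain ⟨x, hx, hface, hlt⟩ := (normal_spec hn).exists_support (G.isOpen_dom e)
      (by rw [hdom]; exact (convex_convexHull ℝ _).interior) (by rw [hj]; exact convex_convexHull ℝ _)
      (face_subset_frontier hn) (measure_face_pos hn)
    refine ⟨j, x, fun _ => ⟨hj, hface, hlt, ?_⟩⟩
    by_contra hcon
    push Not at hcon
    have hconv : Convex ℝ {y : Euc d | 0 ≤ ⟪y - x, G.normal e n⟫} := by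
      intro y hy z hz a b ha hb hab
      simp only [mem_ofPred_eq] at hy hz ⊢
      have : a • y + b • z - x = a • (y - x) + b • (z - x) := by
        have : x = (a + b) • x := by rw [hab, one_smul]
        nth_rewrite 1 [this]
        module
      rw [this, inner_add_left, real_inner_smul_left, real_inner_smul_left]
      positivity
    have hsub : range v ⊆ {y : Euc d | 0 ≤ ⟪y - x, G.normal e n⟫} := by
      rintro _ ⟨i, rfl⟩
      by_cases hij : i = j
      · rw [hij]; exact hcon
      · refine (hface (v i) ?_).ge
        rw [hj]
        exact subset_convexHull ℝ _ ⟨i, hij, rfl⟩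
    obtain ⟨y, hy⟩ := (G.isConnected_dom e).nonempty
    have hy' := hlt y hy
    rw [hdom] at hy
    have := convexHull_min hsub hconv (interior_subset hy)
    exact absurd hy' (not_lt.2 this)
  choose j x hjx using hall
  exact ⟨v, j, x, hjx⟩

variable {d D : ℕ} {ι ν : Type*} [Fintype ν] {G : PolyhedralHypergraph d D ι ν}

/-- Any `d` of the normals of a `d`-simplex are linearly independent. -/
theorem PolyhedralHypergraph.IsSimplex.eq_zero_of_sum_normal {e : ι} (h : G.IsSimplex e)
    {c : ν → ℝ} (hc : ∑ n ∈ nodesOf G e, c n • G.normal e n = 0) {n₀ : ν} (hn₀ : G.Incident e n₀)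
    (hc₀ : c n₀ = 0) {n : ν} (hn : G.Incident e n) : c n = 0 := by
  obtain ⟨v, j, x, hx⟩ := h.exists_support
  by_cases hne : n = n₀
  · rw [hne, hc₀]
  have hj : ∀ n', G.Incident e n' → n' ≠ n → j n ≠ j n' := by
    intro n' hn' hne hjj
    exact hne (eq_of_face_eq hn' hn (by rw [(hx n hn).1, (hx n' hn').1, hjj]))
  have hj₀ : ∀ n', G.Incident e n' → n' ≠ n₀ → j n₀ ≠ j n' := by
    intro n' hn' hne hjj
    exact hne (eq_of_face_eq hn' hn₀ (by rw [(hx n₀ hn₀).1, (hx n' hn').1, hjj]))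
  have hvert : ∀ n', G.Incident e n' → ∀ i, i ≠ j n' → ⟪v i - x n', G.normal e n'⟫ = 0 := by
    intro n' hn' i hi
    refine (hx n' hn').2.1 _ ?_
    rw [(hx n' hn').1]
    exact subset_convexHull ℝ _ ⟨i, hi, rfl⟩
  -- The edge joining the vertices opposite to `n` and `n₀` is tangent to every other facet. As `c
  -- n₀ = 0`, pairing the relation with it isolates `c n`.
  have h0 : ∑ n' ∈ nodesOf G e, c n' * ⟪v (j n) - v (j n₀), G.normal e n'⟫ = 0 := by
    have := congrArg (fun z => ⟪v (j n) - v (j n₀), z⟫) hc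
    simpa only [inner_sum, real_inner_smul_right, inner_zero_right] using this
  have hsplit : ∀ n', ⟪v (j n) - v (j n₀), G.normal e n'⟫ =
      ⟪v (j n) - x n', G.normal e n'⟫ - ⟪v (j n₀) - x n', G.normal e n'⟫ := by
    intro n'
    rw [← inner_sub_left, sub_sub_sub_cancel_right]
  rw [Finset.sum_eq_single_of_mem n (mem_nodesOf.2 hn)] at h0
  · refine (mul_eq_zero.1 h0).resolve_right ?_
    rw [hsplit, hvert n hn (j n₀) (hj₀ n hn hne), sub_zero]
    exact (hx n hn).2.2.2.ne
  · intro n' hn' hne'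
    rw [mem_nodesOf] at hn'
    by_cases hn0 : n' = n₀
    · rw [hn0, hc₀, zero_mul]
    · rw [hsplit, hvert n' hn' _ (hj n' hn' hne'), hvert n' hn' _ (hj₀ n' hn' hn0), sub_zero,
        mul_zero]

variable (G) in
/-- The center of mass of a hyperedge. -/
def centroid (e : ι) : Euc d :=
  ((volume : Measure (Euc d)).real (G.dom e))⁻¹ • ∫ x in G.dom e, x

omit [Fintype ν] in
theorem integral_inner_sub_centroid (e : ι) (w : Euc d) :
    ∫ x in G.dom e, ⟪x - centroid G e, w⟫ = 0 := by
  have hV := G.volume_dom_pos e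
  have hi : IntegrableOn (fun x : Euc d => x) (G.dom e) := integrableOn_dom continuous_id e
  have hw : ∀ z : Euc d, ⟪z, w⟫ = innerSL ℝ w z := fun z => by
    rw [innerSL_apply_apply, real_inner_comm]
  simp only [hw]
  have hs : IntegrableOn (fun x : Euc d => x - centroid G e) (G.dom e) :=
    integrableOn_dom (by fun_prop) e
  rw [ContinuousLinearMap.integral_comp_comm _ hs, integral_sub hi (integrableOn_dom continuous_const e), setIntegral_const, centroid, smul_smul,
    mul_inv_cancel₀ hV.ne', one_smul, sub_self, map_zero]

omit [Fintype ν] in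
theorem integral_inner_affine (e : ι) (c w : Euc d) (a : ℝ) :
    ∫ x in G.dom e, ⟪c + a • (x - centroid G e), w⟫ =
      (volume : Measure (Euc d)).real (G.dom e) * ⟪c, w⟫ := by
  simp only [inner_add_left, real_inner_smul_left]
  rw [integral_add (integrableOn_dom (by fun_prop) e) (integrableOn_dom (by fun_prop) e),
    integral_const_mul, integral_inner_sub_centroid, setIntegral_const, smul_eq_mul, mul_zero,
    add_zero]

omit [Fintype ν] in
theorem integral_inner_affine_sub_centroid (e : ι) (c : Euc d) (a : ℝ) :
    ∫ x in G.dom e, ⟪c + a • (x - centroid G e), x - centroid G e⟫ =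
      a * ∫ x in G.dom e, ‖x - centroid G e‖ ^ 2 := by
  simp only [inner_add_left, real_inner_smul_left, real_inner_self_eq_norm_sq]
  rw [integral_add (integrableOn_dom (by fun_prop) e) (integrableOn_dom (by fun_prop) e),
    integral_const_mul]
  simp only [real_inner_comm _ c, integral_inner_sub_centroid, zero_add]

-- The centroid satisfies the supporting inequality as an average of points that do. This fixes the
-- sign of the source term in the Raviart–Thomas flux.
omit [Fintype ν] in
theorem inner_sub_centroid_nonneg {e : ι} {x w : Euc d} (h : ∀ y ∈ G.dom e, ⟪y - x, w⟫ < 0) :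
    0 ≤ ⟪x - centroid G e, w⟫ := by
  have hV := G.volume_dom_pos e
  have h1 : ∫ y in G.dom e, ⟪y - x, w⟫ =
      (volume : Measure (Euc d)).real (G.dom e) * ⟪centroid G e - x, w⟫ := by
    have := integral_inner_affine (G := G) e (centroid G e - x) w 1
    rw [← this]
    congr 1
    funext y
    congr 1
    module
  have h2 : ∫ y in G.dom e, ⟪y - x, w⟫ ≤ 0 :=
    setIntegral_nonpos (G.isOpen_dom e).measurableSet fun y hy => (h y hy).le
  rw [h1] at h2
  have h3 : ⟪centroid G e - x, w⟫ ≤ 0 := by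
    by_contra hcon
    push Not at hcon
    linarith [mul_pos hV hcon]
  rw [← neg_sub, inner_neg_left]
  linarith

/-! ### Elimination of the Raviart–Thomas unknowns on a simplex -/

section RT

variable {e : ι} {k : ℝ} {f u : Euc d → ℝ} {q : Euc d → Euc d} {lam : ν → ℝ}

/-- Centering the field at the centroid makes its constant and radial parts orthogonal in `L²`, so
the equations for `c`, `u₀` and `a` decouple. The normal component of `y - centroid G e` is constant
on each face, hence given by its value at `x n`. -/
theorem LocalSolution.const_RT0Simplex {x : ν → Euc d}
    (hx : ∀ n, G.Incident e n → ∀ y ∈ G.face e n, ⟪y - x n, G.normal e n⟫ = 0)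
    (h : LocalSolution G e (P0 (Euc d)) (RT0Simplex d) 0 (fun _ => k) f u q lam) :
    ∃ (u₀ : ℝ) (c : Euc d) (a : ℝ), (∀ y, u y = u₀) ∧ (∀ y, q y = c + a • (y - centroid G e)) ∧
      (∀ w, k⁻¹ * ((volume : Measure (Euc d)).real (G.dom e) * ⟪c, w⟫) =
        -∑ n ∈ nodesOf G e, lam n * (G.area e n * ⟪w, G.normal e n⟫)) ∧
      (k⁻¹ * (a * ∫ y in G.dom e, ‖y - centroid G e‖ ^ 2) -
          (volume : Measure (Euc d)).real (G.dom e) * (u₀ * d) =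
        -∑ n ∈ nodesOf G e,
          lam n * (G.area e n * ⟪x n - centroid G e, G.normal e n⟫)) ∧
      (volume : Measure (Euc d)).real (G.dom e) * (a * d) = ∫ y in G.dom e, f y := by
  obtain ⟨u₀, hu⟩ := h.u_mem
  obtain ⟨b, a, hq⟩ := h.q_mem
  obtain rfl : u = fun _ => u₀ := funext hu
  obtain rfl : q = fun y => (b + a • centroid G e) + a • (y - centroid G e) := by
    funext y; rw [hq]; module
  refine ⟨u₀, b + a • centroid G e, a, fun _ => rfl, fun _ => rfl, fun w => ?_, ?_, ?_⟩
  · have := h.primary (fun _ => w) ⟨w, 0, fun _ => by simp⟩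
    simp only [divergence_const, mul_zero, integral_zero, sub_zero, integral_const_mul,
      integral_inner_affine, setIntegral_const, smul_eq_mul] at this
    exact this
  · have hp : (fun y => y - centroid G e) = fun y : Euc d => -centroid G e + (1 : ℝ) • y := by
      funext y; module
    have hdiv : ∀ y, divergence (fun y => y - centroid G e) y = d := by
      intro y
      rw [hp, divergence_affine, one_mul]
    have := h.primary (fun y => y - centroid G e) ⟨-centroid G e, 1, fun y => congrFun hp y⟩
    simp only [hdiv, integral_const_mul, integral_inner_affine_sub_centroid, setIntegral_const,
      smul_eq_mul] at this
    rw [mul_left_comm _ u₀, this]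
    congr 1
    refine Finset.sum_congr rfl fun n hn => ?_
    congr 1
    refine setIntegral_face_eq fun y hy => ?_
    have := hx n (mem_nodesOf.1 hn) y hy
    rw [← sub_add_sub_cancel y (x n), inner_add_left, this, zero_add]
  · have hdiv : ∀ y, divergence (fun y => (b + a • centroid G e) + a • (y - centroid G e)) y = a * d := by
      intro y
      have hp : (fun y => (b + a • centroid G e) + a • (y - centroid G e)) = fun y : Euc d => b + a • y := by
        funext y; module
      rw [hp, divergence_affine]
    have := h.flux (fun _ => 1) ⟨1, fun _ => rfl⟩
    simp only [hdiv, zero_mul, add_zero, zero_add, mul_one, one_mul, setIntegral_const,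
      smul_eq_mul] at this
    exact this

theorem LocalSolution.localMonotone_RT0Simplex (hs : G.IsSimplex e) (hd : d ≠ 0) (hk : 0 < k)
    (h : LocalSolution G e (P0 (Euc d)) (RT0Simplex d) 0 (fun _ => k) f u q lam)
    (hf : 0 ≤ ∫ x in G.dom e, f x) (hgeo : NonobtuseAt G e) :
    LocalMonotone G e lam (numFlux G e 0 u q lam) := by
  obtain ⟨v, j, x, hx⟩ := hs.exists_support
  obtain ⟨u₀, c, a, hu, hq, hc, -, ha⟩ :=
    h.const_RT0Simplex (x := x) fun n hn => (hx n hn).2.1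
  have hV := G.volume_dom_pos e
  set V := (volume : Measure (Euc d)).real (G.dom e)
  have hd' : (0 : ℝ) < d := Nat.cast_pos.2 (Nat.pos_of_ne_zero hd)
  have ha0 : 0 ≤ a := by
    rw [← ha] at hf
    exact nonneg_of_mul_nonneg_left (nonneg_of_mul_nonneg_right hf hV) hd'
  let B : ν → ν → ℝ := fun n n' =>
    k / V * (G.area e n * G.area e n' * ⟪G.normal e n, G.normal e n'⟫)
  have hBsum : ∀ m : ν → ℝ, ∑ n ∈ nodesOf G e, ∑ n' ∈ nodesOf G e, m n * (B n n' * m n') =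
      k / V * ‖∑ n ∈ nodesOf G e, (m n * G.area e n) • G.normal e n‖ ^ 2 := by
    intro m
    rw [← area_mul_matrix_sum, Finset.mul_sum]
    refine Finset.sum_congr rfl fun n _ => ?_
    rw [Finset.mul_sum]
    exact Finset.sum_congr rfl fun n' _ => by simp only [B]; ring
  refine localMonotone_of_matrix (B := B)
    (r := fun n => G.area e n * (a * ⟪x n - centroid G e, G.normal e n⟫)) ?_ ?_ ?_ ?_ ?_
  · intro n hn
    have hΦ : numFlux G e 0 u q lam n = G.area e n *
        (⟪c, G.normal e n⟫ + a * ⟪x n - centroid G e, G.normal e n⟫) := by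
      refine setIntegral_face_eq fun y hy => ?_
      rw [hq, zero_mul, add_zero, inner_add_left, real_inner_smul_left,
        ← sub_add_sub_cancel y (x n), inner_add_left, (hx n hn).2.1 y hy, zero_add]
    have hsum : ∑ n' ∈ nodesOf G e, B n n' * lam n' =
        k / V * G.area e n * ∑ n' ∈ nodesOf G e,
          lam n' * (G.area e n' * ⟪G.normal e n, G.normal e n'⟫) := by
      rw [Finset.mul_sum]
      exact Finset.sum_congr rfl fun n' _ => by simp only [B]; ring
    have hcn : ∑ n' ∈ nodesOf G e, lam n' * (G.area e n' * ⟪G.normal e n, G.normal e n'⟫) =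
        -(k⁻¹ * (V * ⟪c, G.normal e n⟫)) := by
      rw [hc, neg_neg]
    rw [hΦ, hsum, hcn]
    field_simp
    ring
  · intro n hn
    refine mul_nonneg (area_pos hn).le (mul_nonneg ha0 ?_)
    exact inner_sub_centroid_nonneg (hx n hn).2.2.1
  · intro n n' hn hn' hne
    exact mul_nonpos_of_nonneg_of_nonpos (by positivity)
      (mul_nonpos_of_nonneg_of_nonpos (mul_pos (area_pos hn) (area_pos hn')).le
        (hgeo n n' hne hn hn'))
  · intro m
    rw [hBsum]
    positivity
  · intro m _ h0 n₀ hn₀ hm₀ n hn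
    rw [hBsum] at h0
    have h1 := (mul_eq_zero.1 h0).resolve_left (by positivity)
    have h2 := norm_eq_zero.1 (pow_eq_zero_iff two_ne_zero |>.1 h1)
    -- With `τ = 0` there is no variance term. The kernel consists of relations between the normals,
    -- and these are trivial once one coefficient vanishes.
    have h3 := hs.eq_zero_of_sum_normal h2 hn₀ (by rw [hm₀, zero_mul]) hn
    exact (mul_eq_zero.1 h3).resolve_right (area_pos hn).ne'

/-- The equation tested with the radial field `y - centroid G e` expresses `u₀` through `lam` and
`a` with nonnegative weights. -/
theorem LocalSolution.nonneg_RT0Simplex (hs : G.IsSimplex e) (hd : d ≠ 0) (hk : 0 < k)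
    (h : LocalSolution G e (P0 (Euc d)) (RT0Simplex d) 0 (fun _ => k) f u q lam)
    (hf : 0 ≤ ∫ x in G.dom e, f x) (hlam : ∀ n, 0 ≤ lam n) (y : Euc d) : 0 ≤ u y := by
  obtain ⟨v, j, x, hx⟩ := hs.exists_support
  obtain ⟨u₀, c, a, hu, -, -, hu₀, ha⟩ :=
    h.const_RT0Simplex (x := x) fun n hn => (hx n hn).2.1
  rw [hu]
  have hV := G.volume_dom_pos e
  set V := (volume : Measure (Euc d)).real (G.dom e)
  have hd' : (0 : ℝ) < d := Nat.cast_pos.2 (Nat.pos_of_ne_zero hd)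
  have ha0 : 0 ≤ a := by
    rw [← ha] at hf
    exact nonneg_of_mul_nonneg_left (nonneg_of_mul_nonneg_right hf hV) hd'
  have h1 : 0 ≤ ∑ n ∈ nodesOf G e,
      lam n * (G.area e n * ⟪x n - centroid G e, G.normal e n⟫) :=
    Finset.sum_nonneg fun n hn => mul_nonneg (hlam n) (mul_nonneg
      (area_pos (mem_nodesOf.1 hn)).le (inner_sub_centroid_nonneg (hx n (mem_nodesOf.1 hn)).2.2.1))
  have h2 : 0 ≤ k⁻¹ * (a * ∫ y in G.dom e, ‖y - centroid G e‖ ^ 2) :=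
    mul_nonneg (inv_nonneg.2 hk.le) (mul_nonneg ha0 (integral_nonneg fun y => by positivity))
  have h3 : 0 ≤ V * (u₀ * d) := by linarith
  exact nonneg_of_mul_nonneg_left (nonneg_of_mul_nonneg_right h3 hV) hd'

end RT

end HDG

end

noncomputable section

namespace HDG

open PolyhedralHypergraph

/-! ### Integrals over boxes -/

/-- The open box `∏ (a i, b i)`. -/
def box {d : ℕ} (a b : Fin d → ℝ) : Set (Euc d) := {x | ∀ i, a i < x i ∧ x i < b i}

theorem integral_box_prod {d : ℕ} {a b : Fin d → ℝ} (hab : ∀ i, a i ≤ b i)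
    (φ : Fin d → ℝ → ℝ) :
    ∫ x in box a b, ∏ i, φ i (x i) = ∏ i, ∫ t in (a i)..(b i), φ i t := by
  have hpre : box a b = WithLp.ofLp ⁻¹' (univ.pi fun i => Ioo (a i) (b i)) := by
    ext x
    simp [box]
  have h := (PiLp.volume_preserving_ofLp (Fin d)).setIntegral_preimage_emb
    (MeasurableEquiv.toLp 2 (Fin d → ℝ)).symm.measurableEmbedding
    (fun y => ∏ i, φ i (y i)) (univ.pi fun i => Ioo (a i) (b i))
  rw [hpre]
  refine h.trans ?_
  rw [volume_pi, Measure.restrict_pi_pi, integral_fintype_prod_eq_prod]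
  refine Finset.prod_congr rfl fun i _ => ?_
  rw [intervalIntegral.integral_of_le (hab i), integral_Ioc_eq_integral_Ioo]

theorem isBounded_box {d : ℕ} (a b : Fin d → ℝ) : Bornology.IsBounded (box a b) := by
  have h : Bornology.IsBounded (univ.pi fun i => Ioo (a i) (b i)) :=
    Bornology.IsBounded.pi fun i => Metric.isBounded_Ioo _ _
  refine ((PiLp.antilipschitzWith_ofLp 2 _).isBounded_preimage h).subset fun x hx => ?_
  simpa [box] using hx

theorem integrableOn_box {d : ℕ} (a b : Fin d → ℝ) {φ : Euc d → ℝ} (hφ : Continuous φ) :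
    IntegrableOn φ (box a b) :=
  (hφ.continuousOn.integrableOn_compact (isBounded_box a b).isCompact_closure).mono_set
    subset_closure

theorem integral_moment_one (a b : ℝ) : ∫ t in a..b, (t - (a + b) / 2) = 0 := by
  rw [intervalIntegral.integral_sub (by simp) (by simp)]
  simp
  ring

theorem integral_moment_two (a b : ℝ) : ∫ t in a..b, (t - (a + b) / 2) ^ 2 = (b - a) ^ 3 / 12 := by
  rw [intervalIntegral.integral_comp_sub_right (fun t => t ^ 2)]
  simp
  ring

theorem integral_box_one {a b : Fin 1 → ℝ} (hab : a 0 < b 0) (c₀ c₁ c₂ : ℝ) :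
    ∫ x in box a b, (c₀ + c₁ * (x 0 - (a 0 + b 0) / 2) + c₂ * (x 0 - (a 0 + b 0) / 2) ^ 2) =
      c₀ * (b 0 - a 0) + c₂ * ((b 0 - a 0) ^ 3 / 12) := by
  have h := integral_box_prod (a := a) (b := b) (fun i => by fin_cases i; exact hab.le)
    (fun _ t => c₀ + c₁ * (t - (a 0 + b 0) / 2) + c₂ * (t - (a 0 + b 0) / 2) ^ 2)
  simp only [Finset.univ_unique, Fin.default_eq_zero, Finset.prod_singleton] at h
  rw [h, intervalIntegral.integral_add, intervalIntegral.integral_add]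
  · simp only [intervalIntegral.integral_const_mul, integral_moment_one, integral_moment_two,
      intervalIntegral.integral_const, smul_eq_mul]
    ring
  all_goals exact Continuous.intervalIntegrable (by fun_prop) _ _

/-- About the center only the monomials that are even in both variables survive. Degree two per
variable suffices for products of bilinear functions. -/
theorem integral_box_two {a b : Fin 2 → ℝ} (hab : ∀ i, a i < b i) (c : Fin 3 → Fin 3 → ℝ) :
    ∫ x in box a b, (∑ i, ∑ j, c i j * ((x 0 - (a 0 + b 0) / 2) ^ (i : ℕ) *
        (x 1 - (a 1 + b 1) / 2) ^ (j : ℕ))) =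
      c 0 0 * ((b 0 - a 0) * (b 1 - a 1)) + c 2 0 * ((b 0 - a 0) ^ 3 / 12 * (b 1 - a 1)) +
        c 0 2 * ((b 0 - a 0) * ((b 1 - a 1) ^ 3 / 12)) +
        c 2 2 * ((b 0 - a 0) ^ 3 / 12 * ((b 1 - a 1) ^ 3 / 12)) := by
  have hmono : ∀ i j : Fin 3, ∫ x in box a b, c i j * ((x 0 - (a 0 + b 0) / 2) ^ (i : ℕ) *
        (x 1 - (a 1 + b 1) / 2) ^ (j : ℕ)) =
      c i j * ((∫ t in (a 0)..(b 0), (t - (a 0 + b 0) / 2) ^ (i : ℕ)) *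
        ∫ t in (a 1)..(b 1), (t - (a 1 + b 1) / 2) ^ (j : ℕ)) := by
    intro i j
    have h := integral_box_prod (a := a) (b := b) (fun i => (hab i).le)
      (fun l t => (t - (a l + b l) / 2) ^ ((![i, j] l : Fin 3) : ℕ))
    simp only [Fin.prod_univ_two, Matrix.cons_val_zero, Matrix.cons_val_one] at h
    rw [integral_const_mul, h]
  rw [integral_finsetSum _ fun i _ => integrable_finsetSum _ fun j _ =>
    integrableOn_box a b (by fun_prop)]
  have hsum : ∀ i : Fin 3, ∫ x in box a b, (∑ j, c i j * ((x 0 - (a 0 + b 0) / 2) ^ (i : ℕ) *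
        (x 1 - (a 1 + b 1) / 2) ^ (j : ℕ))) = ∑ j : Fin 3, ∫ x in box a b,
        c i j * ((x 0 - (a 0 + b 0) / 2) ^ (i : ℕ) * (x 1 - (a 1 + b 1) / 2) ^ (j : ℕ)) :=
    fun i => integral_finsetSum _ fun j _ => integrableOn_box a b (by fun_prop)
  simp only [hsum, hmono]
  simp [Fin.sum_univ_three, integral_moment_two]
  ring

/-! ### Edges of graphs -/

section Edge

variable {D : ℕ} {ι ν : Type*} {G : PolyhedralHypergraph 1 D ι ν}

/-- The point of the Euclidean line with coordinate `t`. -/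
def pt (t : ℝ) : Euc 1 := EuclideanSpace.single 0 t

@[simp]
theorem pt_zero (t : ℝ) : pt t 0 = t := by simp [pt]

theorem eq_pt (x : Euc 1) : x = pt (x 0) := by
  ext i
  fin_cases i
  simp

theorem inner_eq (x y : Euc 1) : ⟪x, y⟫ = x 0 * y 0 := by
  simp [PiLp.inner_apply, mul_comm]

/-- The Euclidean line is homeomorphic to the real line. -/
def lineHomeo : Euc 1 ≃ₜ ℝ where
  toFun x := x 0
  invFun := pt
  left_inv x := (eq_pt x).symm
  right_inv := pt_zero
  continuous_toFun := by fun_prop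
  continuous_invFun := by
    unfold pt
    exact (PiLp.continuous_toLp 2 _).comp (continuous_pi fun i => by
      fin_cases i; simpa using continuous_id')

/-- A bounded, connected, open subset of the line is an open interval, so no shape assumption is
needed for graphs. -/
theorem PolyhedralHypergraph.exists_dom_eq_box (G : PolyhedralHypergraph 1 D ι ν) (e : ι) :
    ∃ a b : Fin 1 → ℝ, a 0 < b 0 ∧ G.dom e = box a b := by
  set S : Set ℝ := lineHomeo '' G.dom e with hS
  have hopen : IsOpen S := lineHomeo.isOpenMap _ (G.isOpen_dom e)
  have hconn : IsConnected S :=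
    (G.isConnected_dom e).image _ lineHomeo.continuous.continuousOn
  have hbdd : Bornology.IsBounded S :=
    ((G.isBounded_dom e).isCompact_closure.image lineHomeo.continuous).isBounded.subset
      (image_mono subset_closure)
  have hIoo : S = Ioo (sInf S) (sSup S) := by
    refine Subset.antisymm (fun t ht => ?_)
      (hconn.Ioo_csInf_csSup_subset hbdd.bddBelow hbdd.bddAbove)
    obtain ⟨ε, hε, hball⟩ := Metric.isOpen_iff.1 hopen t ht
    have h1 : t - ε / 2 ∈ S := hball (by
      rw [Metric.mem_ball, Real.dist_eq, abs_lt]; constructor <;> linarith)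
    have h2 : t + ε / 2 ∈ S := hball (by
      rw [Metric.mem_ball, Real.dist_eq, abs_lt]; constructor <;> linarith)
    exact ⟨by linarith [csInf_le hbdd.bddBelow h1], by linarith [le_csSup hbdd.bddAbove h2]⟩
  refine ⟨fun _ => sInf S, fun _ => sSup S, ?_, ?_⟩
  · obtain ⟨t, ht⟩ := hconn.nonempty
    rw [hIoo] at ht
    exact ht.1.trans ht.2
  · ext x
    have : x ∈ G.dom e ↔ x 0 ∈ S := by
      rw [hS]
      exact (lineHomeo.injective.mem_set_image (a := x)).symm
    have hx : x 0 ∈ S ↔ sInf S < x 0 ∧ x 0 < sSup S := by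
      conv_lhs => rw [hIoo]
      rfl
    rw [this, hx]
    simp [box]

theorem frontier_box {a b : Fin 1 → ℝ} (hab : a 0 < b 0) :
    frontier (box a b) = {pt (a 0), pt (b 0)} := by
  have : box a b = lineHomeo ⁻¹' Ioo (a 0) (b 0) := by
    ext x
    simp [box, lineHomeo]
  rw [this, ← lineHomeo.preimage_frontier, frontier_Ioo hab]
  ext x
  simp only [mem_preimage, mem_insert_iff, mem_singleton_iff, lineHomeo]
  change x 0 = a 0 ∨ x 0 = b 0 ↔ _
  constructor
  · rintro (h | h)
    · exact Or.inl (by rw [← h]; exact eq_pt x)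
    · exact Or.inr (by rw [← h]; exact eq_pt x)
  · rintro (rfl | rfl) <;> simp

theorem convex_box {d : ℕ} (a b : Fin d → ℝ) : Convex ℝ (box a b) := by
  have : box a b = ⋂ i, (EuclideanSpace.proj i : Euc d →L[ℝ] ℝ) ⁻¹' Ioo (a i) (b i) := by
    ext x
    simp [box]
  rw [this]
  exact convex_iInter fun i =>
    (convex_Ioo (a i) (b i)).is_linear_preimage
      (EuclideanSpace.proj i : Euc d →L[ℝ] ℝ).toLinearMap.isLinear

theorem face_eq_singleton {e : ι} {n : ν} {x : Euc 1}
    (hx : x ∈ G.face e n) : G.face e n = {x} := by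
  refine Subset.antisymm (fun y hy => ?_) (singleton_subset_iff.2 hx)
  have := (G.flat_node n).subsingleton hy hx
  exact (G.chart e).injective this

variable (G) in
/-- The hyperedge `e` of a graph is the interval `(a, b)` with end points `n₀` and `n₁`. -/
structure IsEdge (e : ι) (a b : Fin 1 → ℝ) (n₀ n₁ : ν) : Prop where
  lt : a 0 < b 0
  dom : G.dom e = box a b
  ne : n₀ ≠ n₁
  incident : ∀ n, G.Incident e n ↔ n = n₀ ∨ n = n₁
  face₀ : G.face e n₀ = {pt (a 0)}
  face₁ : G.face e n₁ = {pt (b 0)}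
  normal₀ : G.normal e n₀ 0 = -1
  normal₁ : G.normal e n₁ 0 = 1

theorem PolyhedralHypergraph.exists_isEdge (G : PolyhedralHypergraph 1 D ι ν) (e : ι) :
    ∃ a b n₀ n₁, IsEdge G e a b n₀ n₁ := by
  obtain ⟨a, b, hab, hdom⟩ := G.exists_dom_eq_box e
  have hfr : frontier (G.dom e) = {pt (a 0), pt (b 0)} := by rw [hdom, frontier_box hab]
  obtain ⟨n₀, hn₀, hx₀⟩ := G.exists_incident_mem (e := e) (x := pt (a 0)) (by simp [hfr])
  obtain ⟨n₁, hn₁, hx₁⟩ := G.exists_incident_mem (e := e) (x := pt (b 0)) (by simp [hfr])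
  have hf₀ := face_eq_singleton hx₀
  have hf₁ := face_eq_singleton hx₁
  -- A unit vector on the line is `±1`; the sign is determined by the midpoint, which lies inside
  -- the supporting half-space.
  have hnormal : ∀ n t, G.Incident e n → G.face e n = {pt t} →
      (G.normal e n 0 = 1 ∨ G.normal e n 0 = -1) ∧
        ((a 0 + b 0) / 2 - t) * G.normal e n 0 < 0 := by
    intro n t hn ht
    obtain ⟨x, hx, -, hlt⟩ := (normal_spec hn).exists_support (G.isOpen_dom e)
      (by rw [hdom]; exact convex_box a b) (by rw [ht]; exact convex_singleton _)
      (face_subset_frontier hn) (measure_face_pos hn)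
    rw [ht] at hx
    obtain rfl := mem_singleton_iff.1 hx
    constructor
    · have := (normal_spec hn).1
      rw [← pow_left_inj₀ (norm_nonneg _) zero_le_one two_ne_zero, ← real_inner_self_eq_norm_sq,
        inner_eq, one_pow] at this
      exact mul_self_eq_one_iff.1 this
    · have := hlt (pt ((a 0 + b 0) / 2)) (by
        rw [hdom]
        intro i
        fin_cases i
        simp only [Fin.zero_eta, pt_zero]
        constructor <;> linarith)
      rw [inner_eq] at this
      simpa using this
  refine ⟨a, b, n₀, n₁, hab, hdom, ?_, ?_, hf₀, hf₁, ?_, ?_⟩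
  · rintro rfl
    rw [hf₀] at hf₁
    have := congrArg (fun x : Euc 1 => x 0) (singleton_injective hf₁)
    simp only [pt_zero] at this
    exact hab.ne this
  · intro n
    refine ⟨fun hn => ?_, by rintro (rfl | rfl) <;> assumption⟩
    obtain ⟨x, hx⟩ := face_nonempty hn
    have hxf := face_subset_frontier hn hx
    rw [hfr] at hxf
    have hfx := face_eq_singleton hx
    rcases hxf with rfl | rfl
    · exact Or.inl (eq_of_face_eq hn hn₀ (by rw [hfx, hf₀]))
    · exact Or.inr (eq_of_face_eq hn hn₁ (by rw [hfx, hf₁]))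
  · obtain ⟨h1 | h1, h2⟩ := hnormal n₀ _ hn₀ hf₀
    · rw [h1] at h2; linarith
    · exact h1
  · obtain ⟨h1 | h1, h2⟩ := hnormal n₁ _ hn₁ hf₁
    · exact h1
    · rw [h1] at h2; linarith

/-- Zero-dimensional Hausdorff measure counts points, so boundary integrals on a graph are point
evaluations. -/
theorem integral_face_of_eq_singleton {e : ι} {n : ν} {t : ℝ} (h : G.face e n = {pt t})
    (φ : Euc 1 → ℝ) : ∫ x in G.face e n, φ x ∂μHE[1 - 1] = φ (pt t) := by
  rw [h, Nat.sub_self, Measure.euclideanHausdorffMeasure_zero, Measure.restrict_singleton,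
    Measure.hausdorffMeasure_zero_singleton, one_smul, integral_dirac]

theorem IsEdge.sum_nodesOf [Fintype ν] {e : ι} {a b : Fin 1 → ℝ} {n₀ n₁ : ν}
    (h : IsEdge G e a b n₀ n₁) (φ : ν → ℝ) : ∑ n ∈ nodesOf G e, φ n = φ n₀ + φ n₁ := by
  classical
  have : nodesOf G e = {n₀, n₁} := by
    ext n
    simp [h.incident]
  rw [this, Finset.sum_pair h.ne]

end Edge

end HDG

end

noncomputable section

namespace HDG

open PolyhedralHypergraph

/-! ### Local problems on edges -/

/-- The negative part is decreasing and 1-Lipschitz. -/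
theorem sq_negPart_sub_le (x y : ℝ) :
    (max (-x) 0 - max (-y) 0) ^ 2 ≤ (max (-x) 0 - max (-y) 0) * (y - x) := by
  rcases le_total 0 x with hx | hx <;> rcases le_total 0 y with hy | hy
  · simp [max_eq_right (neg_nonpos.2 hx), max_eq_right (neg_nonpos.2 hy)]
  · rw [max_eq_right (neg_nonpos.2 hx), max_eq_left (neg_nonneg.2 hy)]
    nlinarith
  · rw [max_eq_left (neg_nonneg.2 hx), max_eq_right (neg_nonpos.2 hy)]
    nlinarith
  · rw [max_eq_left (neg_nonneg.2 hx), max_eq_left (neg_nonneg.2 hy)]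
    nlinarith

/-- The affine function on the line with value `v₀` and slope `v₁` at `m`. -/
def affFn (m v₀ v₁ : ℝ) : Euc 1 → ℝ := fun x => v₀ + v₁ * (x 0 - m)

/-- The affine vector field on the line with value `v₀` and slope `v₁` at `m`. -/
def affField (m v₀ v₁ : ℝ) : Euc 1 → Euc 1 := fun x => pt (affFn m v₀ v₁ x)

theorem affFn_mem_P1 (m v₀ v₁ : ℝ) : affFn m v₀ v₁ ∈ P1 1 :=
  ⟨v₀ - v₁ * m, fun _ => v₁, fun x => by simp [affFn]; ring⟩

theorem affFn_mem_P0 (m v₀ : ℝ) : affFn m v₀ 0 ∈ P0 (Euc 1) := ⟨v₀, fun x => by simp [affFn]⟩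

theorem affField_mem {P : Submodule ℝ (Euc 1 → ℝ)} {m v₀ v₁ : ℝ} (h : affFn m v₀ v₁ ∈ P) :
    affField m v₀ v₁ ∈ vec P := by
  intro i
  fin_cases i
  simpa [affField] using h

theorem eq_affFn_of_mem_P1 (m : ℝ) {v : Euc 1 → ℝ} (h : v ∈ P1 1) : ∃ v₀ v₁, v = affFn m v₀ v₁ := by
  obtain ⟨c, b, hv⟩ := h
  refine ⟨c + b 0 * m, b 0, funext fun x => ?_⟩
  rw [hv]
  simp [affFn]
  ring

theorem eq_affFn_of_mem_P0 (m : ℝ) {v : Euc 1 → ℝ} (h : v ∈ P0 (Euc 1)) :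
    ∃ v₀, v = affFn m v₀ 0 := by
  obtain ⟨c, hv⟩ := h
  exact ⟨c, funext fun x => by simp [affFn, hv]⟩

theorem eq_affField {m v₀ v₁ : ℝ} {p : Euc 1 → Euc 1} (h : (fun x => p x 0) = affFn m v₀ v₁) :
    p = affField m v₀ v₁ := by
  funext x
  rw [eq_pt (p x), affField, ← h]

theorem divergence_affField (m v₀ v₁ : ℝ) (x : Euc 1) : divergence (affField m v₀ v₁) x = v₁ := by
  have : affField m v₀ v₁ = fun x => pt (v₀ - v₁ * m) + v₁ • x := by
    funext x
    rw [eq_pt x]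
    ext i
    fin_cases i
    simp [affField, affFn, pt]
    ring
  rw [this, divergence_affine]
  simp

variable {D : ℕ} {ι ν : Type*} [Fintype ν] {G : PolyhedralHypergraph 1 D ι ν} {e : ι}
  {a b : Fin 1 → ℝ} {n₀ n₁ : ν} {U : Submodule ℝ (Euc 1 → ℝ)} {Q : Submodule ℝ (Euc 1 → Euc 1)}
  {τ k : ℝ} {f : Euc 1 → ℝ} {lam : ν → ℝ} {u₀ u₁ q₀ q₁ : ℝ}

/-- The edge acts as a resistor with conductance `c`: the tested flux dominates `c` times the
squared jump of the negative part. -/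
theorem IsEdge.localMonotone (h : IsEdge G e a b n₀ n₁) {Φ : ν → ℝ} {c r₀ r₁ : ℝ} (hc : 0 < c)
    (hr₀ : 0 ≤ r₀) (hr₁ : 0 ≤ r₁) (hΦ₀ : Φ n₀ = c * (lam n₁ - lam n₀) + r₀)
    (hΦ₁ : Φ n₁ = c * (lam n₀ - lam n₁) + r₁) : LocalMonotone G e lam Φ := by
  have hm₀ : 0 ≤ max (-lam n₀) 0 := le_max_right _ _
  have hm₁ : 0 ≤ max (-lam n₁) 0 := le_max_right _ _
  have key := mul_le_mul_of_nonneg_left (sq_negPart_sub_le (lam n₀) (lam n₁)) hc.le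
  have hsum : c * (max (-lam n₀) 0 - max (-lam n₁) 0) ^ 2 ≤
      max (-lam n₀) 0 * Φ n₀ + max (-lam n₁) 0 * Φ n₁ := by
    rw [hΦ₀, hΦ₁]
    nlinarith [mul_nonneg hm₀ hr₀, mul_nonneg hm₁ hr₁]
  unfold LocalMonotone
  rw [h.sum_nodesOf]
  refine ⟨le_trans (by positivity) hsum, fun h0 => ?_⟩
  rw [h0] at hsum
  have hsq : (max (-lam n₀) 0 - max (-lam n₁) 0) ^ 2 = 0 := by
    refine le_antisymm ?_ (sq_nonneg _)
    by_contra hcon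
    push Not at hcon
    linarith [mul_pos hc hcon]
  have heq : max (-lam n₀) 0 = max (-lam n₁) 0 := sub_eq_zero.1 (pow_eq_zero_iff two_ne_zero |>.1 hsq)
  have hiff : 0 ≤ lam n₀ ↔ 0 ≤ lam n₁ := by
    have h' : ∀ x : ℝ, 0 ≤ x ↔ max (-x) 0 = 0 := fun x => by simp
    rw [h', h', heq]
  intro n hn hl n' hn'
  rw [h.incident] at hn hn'
  rcases hn with rfl | rfl <;> rcases hn' with rfl | rfl <;> tauto

theorem IsEdge.primary (h : IsEdge G e a b n₀ n₁)
    (hs : LocalSolution G e U Q τ (fun _ => k) f (affFn ((a 0 + b 0) / 2) u₀ u₁)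
      (affField ((a 0 + b 0) / 2) q₀ q₁) lam) {p₀ p₁ : ℝ}
    (hp : affField ((a 0 + b 0) / 2) p₀ p₁ ∈ Q) :
    k⁻¹ * (q₀ * p₀ * (b 0 - a 0) + q₁ * p₁ * ((b 0 - a 0) ^ 3 / 12)) - u₀ * p₁ * (b 0 - a 0) =
      lam n₀ * (p₀ - p₁ * ((b 0 - a 0) / 2)) - lam n₁ * (p₀ + p₁ * ((b 0 - a 0) / 2)) := by
  have := hs.primary _ hp
  rw [h.sum_nodesOf, integral_face_of_eq_singleton h.face₀, integral_face_of_eq_singleton h.face₁,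
    inner_eq, inner_eq, h.normal₀, h.normal₁, h.dom] at this
  have h1 : ∫ x in box a b, k⁻¹ * ⟪affField ((a 0 + b 0) / 2) q₀ q₁ x,
      affField ((a 0 + b 0) / 2) p₀ p₁ x⟫ =
      k⁻¹ * (q₀ * p₀ * (b 0 - a 0) + q₁ * p₁ * ((b 0 - a 0) ^ 3 / 12)) := by
    rw [integral_const_mul, ← integral_box_one h.lt _ (q₀ * p₁ + q₁ * p₀)]
    congr 2
    funext x
    simp only [inner_eq, affField, affFn, pt_zero]
    ring
  have h2 : ∫ x in box a b, affFn ((a 0 + b 0) / 2) u₀ u₁ x *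
      divergence (affField ((a 0 + b 0) / 2) p₀ p₁) x = u₀ * p₁ * (b 0 - a 0) := by
    have := integral_box_one h.lt (u₀ * p₁) (u₁ * p₁) 0
    rw [zero_mul, add_zero] at this
    rw [← this]
    congr 1
    funext x
    rw [divergence_affField]
    simp only [affFn]
    ring
  rw [h1, h2] at this
  rw [this]
  simp only [affField, affFn, pt_zero]
  ring

theorem IsEdge.flux (h : IsEdge G e a b n₀ n₁)
    (hs : LocalSolution G e U Q τ (fun _ => k) f (affFn ((a 0 + b 0) / 2) u₀ u₁)
      (affField ((a 0 + b 0) / 2) q₀ q₁) lam) {v₀ v₁ : ℝ}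
    (hv : affFn ((a 0 + b 0) / 2) v₀ v₁ ∈ U) :
    q₁ * v₀ * (b 0 - a 0) + τ * ((u₀ - u₁ * ((b 0 - a 0) / 2)) * (v₀ - v₁ * ((b 0 - a 0) / 2)) +
        (u₀ + u₁ * ((b 0 - a 0) / 2)) * (v₀ + v₁ * ((b 0 - a 0) / 2))) =
      τ * (lam n₀ * (v₀ - v₁ * ((b 0 - a 0) / 2)) + lam n₁ * (v₀ + v₁ * ((b 0 - a 0) / 2))) +
        ∫ x in box a b, f x * affFn ((a 0 + b 0) / 2) v₀ v₁ x := by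
  have := hs.flux _ hv
  rw [h.sum_nodesOf, h.sum_nodesOf, integral_face_of_eq_singleton h.face₀,
    integral_face_of_eq_singleton h.face₁, integral_face_of_eq_singleton h.face₀,
    integral_face_of_eq_singleton h.face₁, h.dom] at this
  have h1 : ∫ x in box a b, affFn ((a 0 + b 0) / 2) v₀ v₁ x *
      divergence (affField ((a 0 + b 0) / 2) q₀ q₁) x = q₁ * v₀ * (b 0 - a 0) := by
    have := integral_box_one h.lt (q₁ * v₀) (q₁ * v₁) 0
    rw [zero_mul, add_zero] at this
    rw [← this]
    congr 1
    funext x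
    rw [divergence_affField]
    simp only [affFn]
    ring
  rw [h1] at this
  simp only [affFn, pt_zero] at this ⊢
  ring_nf at this ⊢
  linarith

omit [Fintype ν] in
theorem IsEdge.numFlux₀ (h : IsEdge G e a b n₀ n₁) :
    numFlux G e τ (affFn ((a 0 + b 0) / 2) u₀ u₁) (affField ((a 0 + b 0) / 2) q₀ q₁) lam n₀ =
      -(q₀ - q₁ * ((b 0 - a 0) / 2)) + τ * (u₀ - u₁ * ((b 0 - a 0) / 2) - lam n₀) := by
  rw [numFlux, integral_face_of_eq_singleton h.face₀, inner_eq, h.normal₀]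
  simp only [affFn, affField, pt_zero]
  ring

omit [Fintype ν] in
theorem IsEdge.numFlux₁ (h : IsEdge G e a b n₀ n₁) :
    numFlux G e τ (affFn ((a 0 + b 0) / 2) u₀ u₁) (affField ((a 0 + b 0) / 2) q₀ q₁) lam n₁ =
      q₀ + q₁ * ((b 0 - a 0) / 2) + τ * (u₀ + u₁ * ((b 0 - a 0) / 2) - lam n₁) := by
  rw [numFlux, integral_face_of_eq_singleton h.face₁, inner_eq, h.normal₁]
  simp only [affFn, affField, pt_zero]
  ring

theorem affFn_nonneg {v₀ v₁ : ℝ} (h₀ : 0 ≤ v₀ - v₁ * ((b 0 - a 0) / 2))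
    (h₁ : 0 ≤ v₀ + v₁ * ((b 0 - a 0) / 2)) {x : Euc 1} (hx : x ∈ box a b) :
    0 ≤ affFn ((a 0 + b 0) / 2) v₀ v₁ x := by
  have h2 := hx 0
  have h3 : (b 0 - a 0) * affFn ((a 0 + b 0) / 2) v₀ v₁ x =
      (b 0 - x 0) * (v₀ - v₁ * ((b 0 - a 0) / 2)) +
        (x 0 - a 0) * (v₀ + v₁ * ((b 0 - a 0) / 2)) := by
    simp only [affFn]; ring
  have h4 : 0 ≤ (b 0 - a 0) * affFn ((a 0 + b 0) / 2) v₀ v₁ x := by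
    rw [h3]
    exact add_nonneg (mul_nonneg (by linarith) h₀) (mul_nonneg (by linarith) h₁)
  exact nonneg_of_mul_nonneg_right h4 (by linarith)

omit [Fintype ν] in
theorem IsEdge.source_nonneg (h : IsEdge G e a b n₀ n₁)
    (hf : ∀ᵐ x ∂(volume.restrict (G.dom e)), 0 ≤ f x) {v₀ v₁ : ℝ}
    (h₀ : 0 ≤ v₀ - v₁ * ((b 0 - a 0) / 2)) (h₁ : 0 ≤ v₀ + v₁ * ((b 0 - a 0) / 2)) :
    0 ≤ ∫ x in box a b, f x * affFn ((a 0 + b 0) / 2) v₀ v₁ x := by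
  rw [← h.dom]
  refine integral_nonneg_of_ae ?_
  filter_upwards [hf, ae_restrict_mem (G.isOpen_dom e).measurableSet] with x hx hxe
  rw [h.dom] at hxe
  exact mul_nonneg hx (affFn_nonneg h₀ h₁ hxe)

/-! ### The four pairs of local spaces on an edge -/

section Cases

variable {u : Euc 1 → ℝ} {q : Euc 1 → Euc 1}

theorem IsEdge.P0_P0 (h : IsEdge G e a b n₀ n₁) (hτ : 0 < τ) (hk : 0 < k)
    (hf : ∀ᵐ x ∂(volume.restrict (G.dom e)), 0 ≤ f x)
    (hs : LocalSolution G e (P0 (Euc 1)) (vec (P0 (Euc 1))) τ (fun _ => k) f u q lam) :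
    LocalMonotone G e lam (numFlux G e τ u q lam) ∧
      ((∀ n, 0 ≤ lam n) → ∀ x ∈ G.dom e, 0 ≤ u x) := by
  obtain ⟨u₀, rfl⟩ := eq_affFn_of_mem_P0 ((a 0 + b 0) / 2) hs.u_mem
  obtain ⟨q₀, hq⟩ := eq_affFn_of_mem_P0 ((a 0 + b 0) / 2) (hs.q_mem 0)
  obtain rfl := eq_affField hq
  have hL : 0 < b 0 - a 0 := sub_pos.2 h.lt
  have hp := h.primary hs (affField_mem (affFn_mem_P0 _ 1))
  have hv := h.flux hs (affFn_mem_P0 _ 1)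
  have hF := h.source_nonneg hf (v₀ := 1) (v₁ := 0) (by simp) (by simp)
  set F := ∫ x in box a b, f x * affFn ((a 0 + b 0) / 2) 1 0 x
  have hq₀ : q₀ = k / (b 0 - a 0) * (lam n₀ - lam n₁) := by
    field_simp at hp ⊢
    linarith
  have hu₀ : τ * u₀ = τ * (lam n₀ + lam n₁) / 2 + F / 2 := by linarith
  constructor
  · refine h.localMonotone (c := k / (b 0 - a 0) + τ / 2) (r₀ := F / 2) (r₁ := F / 2)
      (by positivity) (by positivity) (by positivity) ?_ ?_
    · rw [h.numFlux₀, hq₀]; linarith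
    · rw [h.numFlux₁, hq₀]; linarith
  · intro hlam x hx
    rw [h.dom] at hx
    have : 0 ≤ u₀ := by
      have h1 := hlam n₀
      have h2 := hlam n₁
      exact nonneg_of_mul_nonneg_right (by rw [hu₀]; positivity : 0 ≤ τ * u₀) hτ
    exact affFn_nonneg (by simpa) (by simpa) hx

theorem IsEdge.P0_P1 (h : IsEdge G e a b n₀ n₁) (hτ : 0 < τ) (hk : 0 < k)
    (hf : ∀ᵐ x ∂(volume.restrict (G.dom e)), 0 ≤ f x)
    (hs : LocalSolution G e (P0 (Euc 1)) (vec (P1 1)) τ (fun _ => k) f u q lam) :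
    LocalMonotone G e lam (numFlux G e τ u q lam) ∧
      ((∀ n, 0 ≤ lam n) → ∀ x ∈ G.dom e, 0 ≤ u x) := by
  obtain ⟨u₀, rfl⟩ := eq_affFn_of_mem_P0 ((a 0 + b 0) / 2) hs.u_mem
  obtain ⟨q₀, q₁, hq⟩ := eq_affFn_of_mem_P1 ((a 0 + b 0) / 2) (hs.q_mem 0)
  obtain rfl := eq_affField hq
  have hL : 0 < b 0 - a 0 := sub_pos.2 h.lt
  have hp := h.primary hs (affField_mem (affFn_mem_P1 _ 1 0))
  have hp' := h.primary hs (affField_mem (affFn_mem_P1 _ 0 1))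
  have hv := h.flux hs (affFn_mem_P0 _ 1)
  have hF := h.source_nonneg hf (v₀ := 1) (v₁ := 0) (by simp) (by simp)
  set F := ∫ x in box a b, f x * affFn ((a 0 + b 0) / 2) 1 0 x
  set L := b 0 - a 0
  have hq₀ : q₀ = k / L * (lam n₀ - lam n₁) := by
    field_simp at hp ⊢
    linarith
  have hu₀ : u₀ = (lam n₀ + lam n₁) / 2 + q₁ * L ^ 2 / (12 * k) := by
    field_simp at hp' ⊢
    nlinarith
  -- The linear part of the flux is driven by the source alone and inherits its sign, so it enters
  -- `r₀` and `r₁` only.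
  have hq₁ : q₁ * (L + 2 * τ * L ^ 2 / (12 * k)) = F := by
    rw [hu₀] at hv
    field_simp at hv ⊢
    linarith
  have hq₁0 : 0 ≤ q₁ := nonneg_of_mul_nonneg_left (by rwa [hq₁]) (by positivity)
  constructor
  · refine h.localMonotone (c := k / L + τ / 2) (r₀ := q₁ * (L / 2) + τ * (q₁ * L ^ 2 / (12 * k)))
      (r₁ := q₁ * (L / 2) + τ * (q₁ * L ^ 2 / (12 * k)))
      (by positivity) (by positivity) (by positivity) ?_ ?_
    · rw [h.numFlux₀, hq₀, hu₀]; ring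
    · rw [h.numFlux₁, hq₀, hu₀]; ring
  · intro hlam x hx
    rw [h.dom] at hx
    have : 0 ≤ u₀ := by
      have h1 := hlam n₀
      have h2 := hlam n₁
      rw [hu₀]; positivity
    exact affFn_nonneg (by simpa) (by simpa) hx

theorem IsEdge.P1_P0 (h : IsEdge G e a b n₀ n₁) (hτ : 0 < τ) (hk : 0 < k)
    (hf : ∀ᵐ x ∂(volume.restrict (G.dom e)), 0 ≤ f x)
    (hs : LocalSolution G e (P1 1) (vec (P0 (Euc 1))) τ (fun _ => k) f u q lam) :
    LocalMonotone G e lam (numFlux G e τ u q lam) ∧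
      ((∀ n, 0 ≤ lam n) → ∀ x ∈ G.dom e, 0 ≤ u x) := by
  obtain ⟨u₀, u₁, rfl⟩ := eq_affFn_of_mem_P1 ((a 0 + b 0) / 2) hs.u_mem
  obtain ⟨q₀, hq⟩ := eq_affFn_of_mem_P0 ((a 0 + b 0) / 2) (hs.q_mem 0)
  obtain rfl := eq_affField hq
  have hL : 0 < b 0 - a 0 := sub_pos.2 h.lt
  have hp := h.primary hs (affField_mem (affFn_mem_P0 _ 1))
  -- The two test functions are the nodal hat functions, equal to one at one end point and zero at
  -- the other. Each isolates the stabilization term at its end point.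
  have hv₀ := h.flux hs (affFn_mem_P1 _ (1 / 2) (-1 / (b 0 - a 0)))
  have hv₁ := h.flux hs (affFn_mem_P1 _ (1 / 2) (1 / (b 0 - a 0)))
  have hF₀ := h.source_nonneg hf (v₀ := 1 / 2) (v₁ := -1 / (b 0 - a 0))
    (by field_simp; norm_num) (by field_simp; norm_num)
  have hF₁ := h.source_nonneg hf (v₀ := 1 / 2) (v₁ := 1 / (b 0 - a 0))
    (by field_simp; norm_num) (by field_simp; norm_num)
  set F₀ := ∫ x in box a b, f x * affFn ((a 0 + b 0) / 2) (1 / 2) (-1 / (b 0 - a 0)) x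
  set F₁ := ∫ x in box a b, f x * affFn ((a 0 + b 0) / 2) (1 / 2) (1 / (b 0 - a 0)) x
  set L := b 0 - a 0
  have hq₀ : q₀ = k / L * (lam n₀ - lam n₁) := by
    field_simp at hp ⊢
    linarith
  have hLL : 1 / L * (L / 2) = 1 / 2 := by field_simp
  have hLL' : -1 / L * (L / 2) = -1 / 2 := by field_simp
  rw [hLL'] at hv₀
  rw [hLL] at hv₁
  have hu₀ : τ * (u₀ - u₁ * (L / 2) - lam n₀) = F₀ := by linarith
  have hu₁ : τ * (u₀ + u₁ * (L / 2) - lam n₁) = F₁ := by linarith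
  constructor
  · refine h.localMonotone (c := k / L) (r₀ := F₀) (r₁ := F₁) (by positivity) hF₀ hF₁ ?_ ?_
    · rw [h.numFlux₀, hq₀, hu₀]; ring
    · rw [h.numFlux₁, hq₀, hu₁]; ring
  · intro hlam x hx
    rw [h.dom] at hx
    rw [← hu₀] at hF₀
    rw [← hu₁] at hF₁
    have h1 := nonneg_of_mul_nonneg_right hF₀ hτ
    have h2 := nonneg_of_mul_nonneg_right hF₁ hτ
    exact affFn_nonneg (by linarith [hlam n₀]) (by linarith [hlam n₁]) hx

theorem IsEdge.P1_P1 (h : IsEdge G e a b n₀ n₁) (hτ : 0 < τ) (hk : 0 < k)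
    (hf : ∀ᵐ x ∂(volume.restrict (G.dom e)), 0 ≤ f x)
    (hs : LocalSolution G e (P1 1) (vec (P1 1)) τ (fun _ => k) f u q lam) :
    LocalMonotone G e lam (numFlux G e τ u q lam) ∧
      ((∀ n, 0 ≤ lam n) → 0 ≤ (⨍ x in G.dom e, u x) ∧
        ((∃ c : ℝ, ∀ᵐ x ∂(volume.restrict (G.dom e)), f x = c) → ∀ x ∈ G.dom e, 0 ≤ u x)) := by
  obtain ⟨u₀, u₁, rfl⟩ := eq_affFn_of_mem_P1 ((a 0 + b 0) / 2) hs.u_mem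
  obtain ⟨q₀, q₁, hq⟩ := eq_affFn_of_mem_P1 ((a 0 + b 0) / 2) (hs.q_mem 0)
  obtain rfl := eq_affField hq
  have hL : 0 < b 0 - a 0 := sub_pos.2 h.lt
  have hp := h.primary hs (affField_mem (affFn_mem_P1 _ 1 0))
  have hp' := h.primary hs (affField_mem (affFn_mem_P1 _ 0 1))
  have hv₀ := h.flux hs (affFn_mem_P1 _ (1 / 2) (-1 / (b 0 - a 0)))
  have hv₁ := h.flux hs (affFn_mem_P1 _ (1 / 2) (1 / (b 0 - a 0)))
  have hF₀ := h.source_nonneg hf (v₀ := 1 / 2) (v₁ := -1 / (b 0 - a 0))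
    (by field_simp; norm_num) (by field_simp; norm_num)
  have hF₁ := h.source_nonneg hf (v₀ := 1 / 2) (v₁ := 1 / (b 0 - a 0))
    (by field_simp; norm_num) (by field_simp; norm_num)
  have hconst : (∃ c : ℝ, ∀ᵐ x ∂(volume.restrict (G.dom e)), f x = c) → ∃ c : ℝ, ∀ v₁ : ℝ,
      ∫ x in box a b, f x * affFn ((a 0 + b 0) / 2) (1 / 2) v₁ x = c := by
    rintro ⟨c, hc⟩
    refine ⟨c * (1 / 2) * (b 0 - a 0), fun v₁ => ?_⟩
    rw [h.dom] at hc
    have h1 : ∫ x in box a b, f x * affFn ((a 0 + b 0) / 2) (1 / 2) v₁ x =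
        ∫ x in box a b, c * affFn ((a 0 + b 0) / 2) (1 / 2) v₁ x := by
      refine integral_congr_ae ?_
      filter_upwards [hc] with x hx
      rw [hx]
    have h2 := integral_box_one h.lt (c * (1 / 2)) (c * v₁) 0
    rw [zero_mul, add_zero] at h2
    rw [h1, ← h2]
    congr 1
    funext x
    simp only [affFn]
    ring
  have hmean : ∫ x in box a b, affFn ((a 0 + b 0) / 2) u₀ u₁ x = u₀ * (b 0 - a 0) := by
    have h2 := integral_box_one h.lt u₀ u₁ 0
    rw [zero_mul, add_zero] at h2
    rw [← h2]
    congr 1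
    funext x
    simp only [affFn]
    ring
  generalize hF₀' : ∫ x in box a b, f x * affFn ((a 0 + b 0) / 2) (1 / 2) (-1 / (b 0 - a 0)) x = F₀
    at *
  generalize hF₁' : ∫ x in box a b, f x * affFn ((a 0 + b 0) / 2) (1 / 2) (1 / (b 0 - a 0)) x = F₁
    at *
  set L := b 0 - a 0
  have hq₀ : q₀ = k / L * (lam n₀ - lam n₁) := by
    field_simp at hp ⊢
    linarith
  have hLL : 1 / L * (L / 2) = 1 / 2 := by field_simp
  have hLL' : -1 / L * (L / 2) = -1 / 2 := by field_simp
  rw [hLL'] at hv₀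
  rw [hLL] at hv₁
  -- The left side is the numerical flux at `n₀` up to the constant part `q₀`, so `F₀` is precisely
  -- the source term of that flux.
  have hu₀ : q₁ * (L / 2) + τ * (u₀ - u₁ * (L / 2) - lam n₀) = F₀ := by linarith
  have hu₁ : q₁ * (L / 2) + τ * (u₀ + u₁ * (L / 2) - lam n₁) = F₁ := by linarith
  have hq₁ : q₁ = 12 * k / L ^ 2 * (u₀ - (lam n₀ + lam n₁) / 2) := by
    field_simp at hp' ⊢
    nlinarith
  have hmid : (12 * k / L + 2 * τ) * (u₀ - (lam n₀ + lam n₁) / 2) = F₀ + F₁ := by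
    have : q₁ * L = 12 * k / L * (u₀ - (lam n₀ + lam n₁) / 2) := by
      rw [hq₁]; field_simp
    linarith
  have hmid0 : 0 ≤ u₀ - (lam n₀ + lam n₁) / 2 :=
    nonneg_of_mul_nonneg_right (by rw [hmid]; positivity) (by positivity : 0 < 12 * k / L + 2 * τ)
  refine ⟨?_, fun hlam => ⟨?_, fun hc => ?_⟩⟩
  · refine h.localMonotone (c := k / L) (r₀ := F₀) (r₁ := F₁) (by positivity) hF₀ hF₁ ?_ ?_
    · rw [h.numFlux₀, hq₀, ← hu₀]; ring
    · rw [h.numFlux₁, hq₀, ← hu₁]; ring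
  · rw [setAverage_eq, h.dom, hmean]
    have : 0 ≤ u₀ := by linarith [hlam n₀, hlam n₁]
    exact smul_nonneg (inv_nonneg.2 measureReal_nonneg) (mul_nonneg this hL.le)
  · obtain ⟨c, hc⟩ := hconst hc
    -- For constant `f` the hat functions carry equal loads, so `u - lam` agrees at both end points
    -- with its nonnegative mean. Otherwise only the mean is controlled.
    have hFF : F₀ = F₁ := by rw [← hF₀', ← hF₁', hc, hc]
    intro x hx
    rw [h.dom] at hx
    have hsum : q₁ * L + 2 * τ * (u₀ - (lam n₀ + lam n₁) / 2) = F₀ + F₁ := by linarith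
    refine affFn_nonneg ?_ ?_ hx
    · have h1 : τ * (u₀ - u₁ * (L / 2) - lam n₀) = τ * (u₀ - (lam n₀ + lam n₁) / 2) := by linarith
      have h2 := mul_left_cancel₀ hτ.ne' h1
      linarith [hlam n₀]
    · have h1 : τ * (u₀ + u₁ * (L / 2) - lam n₁) = τ * (u₀ - (lam n₀ + lam n₁) / 2) := by linarith
      have h2 := mul_left_cancel₀ hτ.ne' h1
      linarith [hlam n₁]

end Cases

end HDG

end

noncomputable section

namespace HDG

open PolyhedralHypergraph

/-! ### Sides of rectangles -/

/-- The point of the plane whose `i`-th coordinate is `c` and whose other coordinate is `t`. -/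
def linePt (i : Fin 2) (c t : ℝ) : Euc 2 := WithLp.toLp 2 fun j => if j = i then c else t

@[simp]
theorem linePt_self (i : Fin 2) (c t : ℝ) : linePt i c t i = c := by simp [linePt]

@[simp]
theorem linePt_other (i : Fin 2) (c t : ℝ) : linePt i c t (1 - i) = t := by
  fin_cases i <;> simp [linePt]

theorem isometry_linePt (i : Fin 2) (c : ℝ) : Isometry (linePt i c) := by
  refine Isometry.of_dist_eq fun t t' => ?_
  rw [EuclideanSpace.dist_eq, Fin.sum_univ_two]
  fin_cases i <;> simp [linePt, Real.sqrt_sq_eq_abs, Real.dist_eq]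

/-- The side of the rectangle `∏ (a i, b i)` on which the `i`-th coordinate is `c`. -/
def side (a b : Fin 2 → ℝ) (i : Fin 2) (c : ℝ) : Set (Euc 2) :=
  {x | (∀ j, a j ≤ x j ∧ x j ≤ b j) ∧ x i = c}

theorem side_eq_image {a b : Fin 2 → ℝ} {i : Fin 2} {c : ℝ} (hc : a i ≤ c ∧ c ≤ b i) :
    side a b i c = linePt i c '' Icc (a (1 - i)) (b (1 - i)) := by
  ext x
  constructor
  · rintro ⟨hx, hxi⟩
    refine ⟨x (1 - i), hx _, ?_⟩
    ext j
    fin_cases i <;> fin_cases j <;> simp_all [linePt]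
  · rintro ⟨t, ht, rfl⟩
    refine ⟨fun j => ?_, linePt_self i c t⟩
    fin_cases i <;> fin_cases j <;> simp_all [linePt]

theorem convex_side (a b : Fin 2 → ℝ) (i : Fin 2) (c : ℝ) : Convex ℝ (side a b i c) := by
  intro x hx y hy α β hα hβ hαβ
  refine ⟨fun j => convex_Icc (a j) (b j) (hx.1 j) (hy.1 j) hα hβ hαβ, ?_⟩
  simp [hx.2, hy.2, ← add_mul, hαβ]

/-- The side is an isometric image of an interval, and isometries carry Hausdorff measure on the
line, which is length, to Hausdorff measure on their range. -/
theorem integral_side {a b : Fin 2 → ℝ} (hab : ∀ i, a i < b i) {i : Fin 2} {c : ℝ}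
    (hc : a i ≤ c ∧ c ≤ b i) (φ : Euc 2 → ℝ) :
    ∫ x in side a b i c, φ x ∂μHE[2 - 1] =
      ∫ t in (a (1 - i))..(b (1 - i)), φ (linePt i c t) := by
  have hiso := isometry_linePt i c
  have hvol : (μHE[2 - 1] : Measure ℝ) = volume := by
    have := InnerProductSpace.euclideanHausdorffMeasure_eq_volume (V := ℝ)
    rwa [Module.finrank_self] at this
  have hmap := hiso.map_euclideanHausdorffMeasure (d := 2 - 1)
  rw [hvol] at hmap
  have hsub : side a b i c ⊆ range (linePt i c) := by
    rw [side_eq_image hc]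
    exact image_subset_range _ _
  rw [← Measure.restrict_restrict_of_subset hsub, ← hmap,
    hiso.isClosedEmbedding.measurableEmbedding.setIntegral_map, side_eq_image hc,
    preimage_image_eq _ hiso.injective, intervalIntegral.integral_of_le (hab _).le,
    integral_Icc_eq_integral_Ioc]

theorem inner_eq_two (x y : Euc 2) : ⟪x, y⟫ = x 0 * y 0 + x 1 * y 1 := by
  simp [PiLp.inner_apply, Fin.sum_univ_two, mul_comm]

section Rectangle

variable {D : ℕ} {ι ν : Type*} {G : PolyhedralHypergraph 2 D ι ν} {e : ι} {a b : Fin 2 → ℝ}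

variable (G) in
/-- The hyperedge `e` is the rectangle `∏ (a i, b i)`; its sides `x i = a i` and `x i = b i` are the
hypernodes `lo i` and `hi i`. -/
structure IsRect (e : ι) (a b : Fin 2 → ℝ) (lo hi : Fin 2 → ν) : Prop where
  lt : ∀ i, a i < b i
  dom : G.dom e = box a b
  incident : ∀ n, G.Incident e n ↔ ∃ i, n = lo i ∨ n = hi i
  face_lo : ∀ i, G.face e (lo i) = side a b i (a i)
  face_hi : ∀ i, G.face e (hi i) = side a b i (b i)
  normal_lo : ∀ i, G.normal e (lo i) = EuclideanSpace.single i (-1)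
  normal_hi : ∀ i, G.normal e (hi i) = EuclideanSpace.single i 1

/-- Both end points of the side lie in the supporting hyperplane, so the tangential component of the
normal vanishes. The center of the rectangle determines the sign of the other one. -/
theorem normal_of_face_eq_side (hab : ∀ i, a i < b i) (hdom : G.dom e = box a b) {n : ν}
    (hn : G.Incident e n) {i : Fin 2} {c : ℝ} (hc : a i ≤ c ∧ c ≤ b i)
    (hface : G.face e n = side a b i c) :
    ∃ σ : ℝ, (σ = 1 ∨ σ = -1) ∧ ((a i + b i) / 2 - c) * σ < 0 ∧
      G.normal e n = EuclideanSpace.single i σ := by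
  obtain ⟨x, hx, hzero, hlt⟩ := (normal_spec hn).exists_support (G.isOpen_dom e)
    (by rw [hdom]; exact convex_box a b) (by rw [hface]; exact convex_side _ _ _ _)
    (face_subset_frontier hn) (measure_face_pos hn)
  rw [hface] at hx hzero
  set w := G.normal e n
  have h1 := hzero (linePt i c (a (1 - i)))
    (by rw [side_eq_image hc]; exact mem_image_of_mem _ (left_mem_Icc.2 (hab _).le))
  have h2 := hzero (linePt i c (b (1 - i)))
    (by rw [side_eq_image hc]; exact mem_image_of_mem _ (right_mem_Icc.2 (hab _).le))
  have h3 : (b (1 - i) - a (1 - i)) * w (1 - i) = 0 := by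
    rw [inner_eq_two] at h1 h2
    fin_cases i <;> simp [linePt, -mul_eq_zero] at h1 h2 ⊢ <;> linarith
  have hw := (mul_eq_zero.1 h3).resolve_left (sub_pos.2 (hab _)).ne'
  have hnorm : w i * w i = 1 := by
    have := (normal_spec hn).1
    rw [← pow_left_inj₀ (norm_nonneg _) zero_le_one two_ne_zero, ← real_inner_self_eq_norm_sq,
      inner_eq_two, one_pow] at this
    fin_cases i <;> simp [w] at hw this ⊢ <;> simpa [hw] using this
  refine ⟨w i, mul_self_eq_one_iff.1 hnorm, ?_, ?_⟩
  · have hmid : WithLp.toLp 2 (fun j => (a j + b j) / 2) ∈ G.dom e := by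
      rw [hdom]
      intro j
      have := hab j
      simp only
      constructor <;> linarith
    have h4 := hlt _ hmid
    have hxi := hx.2
    rw [inner_eq_two] at h4
    fin_cases i <;> simp at hw hxi h4 ⊢ <;> simpa [hw, hxi] using h4
  · ext j
    fin_cases i <;> fin_cases j <;> simp at hw ⊢ <;> exact hw

theorem PolyhedralHypergraph.IsRectangle.exists_isRect (h : G.IsRectangle e a b) :
    ∃ lo hi, IsRect G e a b lo hi := by
  obtain ⟨hab, hdom, hfaces⟩ := h
  have hlo : ∀ i, ∃ n, G.Incident e n ∧ G.face e n = side a b i (a i) := by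
    intro i
    have : side a b i (a i) ∈ G.faces e := by
      rw [hfaces]
      exact ⟨i, Or.inl rfl⟩
    exact this
  have hhi : ∀ i, ∃ n, G.Incident e n ∧ G.face e n = side a b i (b i) := by
    intro i
    have : side a b i (b i) ∈ G.faces e := by
      rw [hfaces]
      exact ⟨i, Or.inr rfl⟩
    exact this
  choose lo hlo hflo using hlo
  choose hi hhi hfhi using hhi
  refine ⟨lo, hi, hab, hdom, fun n => ⟨fun hn => ?_, ?_⟩, hflo, hfhi, fun i => ?_, fun i => ?_⟩
  · have hmem : G.face e n ∈ G.faces e := ⟨n, hn, rfl⟩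
    rw [hfaces] at hmem
    obtain ⟨i, hi' | hi'⟩ := hmem
    · exact ⟨i, Or.inl (eq_of_face_eq hn (hlo i) (by rw [hi', hflo]; rfl))⟩
    · exact ⟨i, Or.inr (eq_of_face_eq hn (hhi i) (by rw [hi', hfhi]; rfl))⟩
  · rintro ⟨i, rfl | rfl⟩
    · exact hlo i
    · exact hhi i
  · have := hab i
    obtain ⟨σ, rfl | rfl, hσ, hw⟩ :=
      normal_of_face_eq_side hab hdom (hlo i) ⟨le_rfl, this.le⟩ (hflo i)
    · linarith
    · exact hw
  · have := hab i
    obtain ⟨σ, rfl | rfl, hσ, hw⟩ :=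
      normal_of_face_eq_side hab hdom (hhi i) ⟨this.le, le_rfl⟩ (hfhi i)
    · exact hw
    · linarith

theorem IsRect.sum_nodesOf [Fintype ν] {lo hi : Fin 2 → ν} (h : IsRect G e a b lo hi)
    (φ : ν → ℝ) : ∑ n ∈ nodesOf G e, φ n = ∑ i, (φ (lo i) + φ (hi i)) := by
  classical
  have hne : ∀ i j : Fin 2, ∀ s t : ℝ, s ≠ 0 → (i ≠ j ∨ s ≠ t) →
      (EuclideanSpace.single i s : Euc 2) ≠ EuclideanSpace.single j t := by
    intro i j s t hs hij heq
    have := congrArg (fun x : Euc 2 => x i) heq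
    by_cases hji : i = j
    · subst hji
      simp at this
      exact hij.resolve_left (by simp) this
    · simp [hji] at this
      exact hs this
  have hlh : ∀ i j, lo i ≠ hi j := by
    intro i j heq
    have := congrArg (G.normal e) heq
    rw [h.normal_lo, h.normal_hi] at this
    exact hne i j (-1) 1 (by norm_num) (Or.inr (by norm_num)) this
  have hll : lo 0 ≠ lo 1 := by
    intro heq
    have := congrArg (G.normal e) heq
    rw [h.normal_lo, h.normal_lo] at this
    exact hne 0 1 (-1) (-1) (by norm_num) (Or.inl (by norm_num)) this
  have hhh : hi 0 ≠ hi 1 := by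
    intro heq
    have := congrArg (G.normal e) heq
    rw [h.normal_hi, h.normal_hi] at this
    exact hne 0 1 1 1 (by norm_num) (Or.inl (by norm_num)) this
  have : nodesOf G e = {lo 0, hi 0, lo 1, hi 1} := by
    ext n
    simp [h.incident, Fin.exists_fin_two, or_assoc]
  rw [this, Finset.sum_insert, Finset.sum_insert, Finset.sum_pair (hlh 1 1), Fin.sum_univ_two]
  · ring
  · simp [(hlh 1 0).symm, hhh]
  · simp [hlh, hll]

end Rectangle

/-! ### Bilinear vector fields on rectangles -/

/-- The vector field with bilinear components
`A i + B i ξ i + C i ξ (1 - i) + E i ξ i ξ (1 - i)`, where `ξ = x - m`. -/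
def bilinField (m A B C E : Fin 2 → ℝ) : Euc 2 → Euc 2 := fun x => WithLp.toLp 2 fun i =>
  A i + B i * (x i - m i) + C i * (x (1 - i) - m (1 - i)) +
    E i * ((x i - m i) * (x (1 - i) - m (1 - i)))

theorem sum_finset_fin_two (g : Finset (Fin 2) → ℝ) :
    ∑ S, g S = g ∅ + g {0} + g {1} + g {0, 1} := by
  have : (Finset.univ : Finset (Finset (Fin 2))) = {∅, {0}, {1}, {0, 1}} := by decide
  rw [this, Finset.sum_insert (by decide), Finset.sum_insert (by decide),
    Finset.sum_pair (by decide)]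
  ring

theorem exists_eq_bilinField (m : Fin 2 → ℝ) {p : Euc 2 → Euc 2} (hp : p ∈ vec (Q1 2)) :
    ∃ A B C E, p = bilinField m A B C E := by
  obtain ⟨c, hc⟩ := hp 0
  obtain ⟨c', hc'⟩ := hp 1
  simp only [sum_finset_fin_two] at hc hc'
  refine ⟨![c ∅ + c {0} * m 0 + c {1} * m 1 + c {0, 1} * m 0 * m 1,
      c' ∅ + c' {0} * m 0 + c' {1} * m 1 + c' {0, 1} * m 0 * m 1],
    ![c {0} + c {0, 1} * m 1, c' {1} + c' {0, 1} * m 0],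
    ![c {1} + c {0, 1} * m 0, c' {0} + c' {0, 1} * m 1], ![c {0, 1}, c' {0, 1}],
    funext fun x => ?_⟩
  ext i
  fin_cases i
  · refine (hc x).trans ?_
    simp [bilinField]
    ring
  · refine (hc' x).trans ?_
    simp [bilinField]
    ring

theorem bilinField_mem_RT0 (m A B : Fin 2 → ℝ) : bilinField m A B 0 0 ∈ RT0Rect 2 :=
  ⟨fun i => A i - B i * m i, B, fun x i => by simp [bilinField]; ring⟩

theorem RT0Rect_le_P1 : RT0Rect 2 ≤ vec (P1 2) := by
  rintro p ⟨c, a, hp⟩ i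
  refine ⟨c i, fun j => if j = i then a i else 0, fun x => ?_⟩
  simp [hp]

theorem P1_le_Q1 : vec (P1 2) ≤ vec (Q1 2) := by
  intro p hp i
  obtain ⟨c, b, h⟩ := hp i
  refine ⟨fun S => if S = ∅ then c else if S = {0} then b 0 else if S = {1} then b 1 else 0,
    fun x => ?_⟩
  have h1 : ({1} : Finset (Fin 2)) ≠ {0} := by decide
  have h2 : ({0, 1} : Finset (Fin 2)) ≠ {0} := by decide
  have h3 : ({0, 1} : Finset (Fin 2)) ≠ {1} := by decide
  rw [h, sum_finset_fin_two, Fin.sum_univ_two]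
  simp [h1, h2, h3]
  ring

theorem divergence_bilinField (m A B C E : Fin 2 → ℝ) (x : Euc 2) :
    divergence (bilinField m A B C E) x = ∑ i, (B i + E i * (x (1 - i) - m (1 - i))) := by
  have hc : ∀ j, HasFDerivAt (fun y : Euc 2 => y j - m j)
      (EuclideanSpace.proj j : Euc 2 →L[ℝ] ℝ) x := fun j =>
    (EuclideanSpace.proj j : Euc 2 →L[ℝ] ℝ).hasFDerivAt.sub_const _
  rw [divergence_eq_of_hasFDerivAt fun i =>
    ((((hc i).const_mul (B i)).const_add (A i)).add ((hc (1 - i)).const_mul (C i))).add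
      (((hc i).mul (hc (1 - i))).const_mul (E i))]
  refine Finset.sum_congr rfl fun i _ => ?_
  fin_cases i <;> simp

end HDG

end

noncomputable section

namespace HDG

open PolyhedralHypergraph

/-! ### Local problems on rectangles -/

/-- The center of the rectangle `∏ (a i, b i)`. -/
def boxMid (a b : Fin 2 → ℝ) : Fin 2 → ℝ := fun i => (a i + b i) / 2

theorem integral_affine (α β c₀ c₁ : ℝ) :
    ∫ t in α..β, (c₀ + c₁ * (t - (α + β) / 2)) = c₀ * (β - α) := by
  rw [intervalIntegral.integral_add (by simp) (Continuous.intervalIntegrable (by fun_prop) _ _),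
    intervalIntegral.integral_const_mul, integral_moment_one]
  simp
  ring

section Integrals

variable {a b : Fin 2 → ℝ}

theorem integral_inner_bilinField (hab : ∀ i, a i < b i) (k : ℝ) (A B C E A' B' C' E' : Fin 2 → ℝ) :
    ∫ x in box a b, k⁻¹ * ⟪bilinField (boxMid a b) A B C E x,
        bilinField (boxMid a b) A' B' C' E' x⟫ =
      k⁻¹ * ((b 0 - a 0) * (b 1 - a 1) * ∑ i, (A i * A' i + B i * B' i * ((b i - a i) ^ 2 / 12) +
        C i * C' i * ((b (1 - i) - a (1 - i)) ^ 2 / 12) +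
        E i * E' i * ((b 0 - a 0) ^ 2 * (b 1 - a 1) ^ 2 / 144))) := by
  rw [integral_const_mul]
  congr 1
  have h := integral_box_two hab !![A 0 * A' 0 + A 1 * A' 1,
      A 0 * C' 0 + C 0 * A' 0 + (A 1 * B' 1 + B 1 * A' 1), C 0 * C' 0 + B 1 * B' 1;
    A 0 * B' 0 + B 0 * A' 0 + (A 1 * C' 1 + C 1 * A' 1),
      A 0 * E' 0 + E 0 * A' 0 + B 0 * C' 0 + C 0 * B' 0 +
        (A 1 * E' 1 + E 1 * A' 1 + B 1 * C' 1 + C 1 * B' 1),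
      C 0 * E' 0 + E 0 * C' 0 + (B 1 * E' 1 + E 1 * B' 1);
    B 0 * B' 0 + C 1 * C' 1, B 0 * E' 0 + E 0 * B' 0 + (C 1 * E' 1 + E 1 * C' 1),
      E 0 * E' 0 + E 1 * E' 1]
  refine Eq.trans ?_ (h.trans ?_)
  · congr 1
    funext x
    simp [Fin.sum_univ_three, inner_eq_two, bilinField, boxMid]
    ring
  · simp [Fin.sum_univ_two]
    ring

theorem integral_divergence_bilinField (hab : ∀ i, a i < b i) (u₀ : ℝ) (A B C E : Fin 2 → ℝ) :
    ∫ x in box a b, u₀ * divergence (bilinField (boxMid a b) A B C E) x =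
      u₀ * ((b 0 - a 0) * (b 1 - a 1) * ∑ i, B i) := by
  rw [integral_const_mul]
  congr 1
  have h := integral_box_two hab !![B 0 + B 1, E 0, 0; E 1, 0, 0; 0, 0, 0]
  refine Eq.trans ?_ (h.trans ?_)
  · congr 1
    funext x
    rw [divergence_bilinField]
    simp [Fin.sum_univ_three, Fin.sum_univ_two, boxMid]
    ring
  · simp [Fin.sum_univ_two]
    ring

end Integrals

variable {D : ℕ} {ι ν : Type*} {G : PolyhedralHypergraph 2 D ι ν} {e : ι} {a b : Fin 2 → ℝ}
  {lo hi : Fin 2 → ν}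

theorem IsRect.integral_lo (h : IsRect G e a b lo hi) (A B C E : Fin 2 → ℝ) (i : Fin 2) :
    ∫ x in G.face e (lo i), ⟪bilinField (boxMid a b) A B C E x, G.normal e (lo i)⟫ ∂μHE[2 - 1] =
      -((b (1 - i) - a (1 - i)) * (A i - B i * ((b i - a i) / 2))) := by
  have hi := h.lt i
  rw [h.face_lo, h.normal_lo, integral_side h.lt ⟨le_rfl, hi.le⟩]
  simp only [EuclideanSpace.inner_single_right, bilinField, boxMid, linePt_self, linePt_other]
  have := integral_affine (a (1 - i)) (b (1 - i)) (-(A i + B i * (a i - (a i + b i) / 2)))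
    (-(C i + E i * (a i - (a i + b i) / 2)))
  refine Eq.trans ?_ (this.trans ?_)
  · congr 1
    funext t
    simp
    ring
  · ring

theorem IsRect.integral_hi (h : IsRect G e a b lo hi) (A B C E : Fin 2 → ℝ) (i : Fin 2) :
    ∫ x in G.face e (hi i), ⟪bilinField (boxMid a b) A B C E x, G.normal e (hi i)⟫ ∂μHE[2 - 1] =
      (b (1 - i) - a (1 - i)) * (A i + B i * ((b i - a i) / 2)) := by
  have hi := h.lt i
  rw [h.face_hi, h.normal_hi, integral_side h.lt ⟨hi.le, le_rfl⟩]
  simp only [EuclideanSpace.inner_single_right, bilinField, boxMid, linePt_self, linePt_other]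
  have := integral_affine (a (1 - i)) (b (1 - i)) (A i + B i * (b i - (a i + b i) / 2))
    (C i + E i * (b i - (a i + b i) / 2))
  refine Eq.trans ?_ (this.trans ?_)
  · congr 1
    funext t
    simp
    ring
  · ring

theorem IsRect.integral_const_lo (h : IsRect G e a b lo hi) (c : ℝ) (i : Fin 2) :
    ∫ _ in G.face e (lo i), c ∂μHE[2 - 1] = (b (1 - i) - a (1 - i)) * c := by
  rw [h.face_lo, integral_side h.lt ⟨le_rfl, (h.lt i).le⟩, intervalIntegral.integral_const,
    smul_eq_mul]

theorem IsRect.integral_const_hi (h : IsRect G e a b lo hi) (c : ℝ) (i : Fin 2) :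
    ∫ _ in G.face e (hi i), c ∂μHE[2 - 1] = (b (1 - i) - a (1 - i)) * c := by
  rw [h.face_hi, integral_side h.lt ⟨(h.lt i).le, le_rfl⟩, intervalIntegral.integral_const,
    smul_eq_mul]

variable [Fintype ν] {Q Q' : Submodule ℝ (Euc 2 → Euc 2)} {τ k : ℝ} {f u : Euc 2 → ℝ}
  {q : Euc 2 → Euc 2} {lam : ν → ℝ}

theorem IsRect.sum_inner_normal (h : IsRect G e a b lo hi) (A B C E : Fin 2 → ℝ) (lam : ν → ℝ) :
    ∑ n ∈ nodesOf G e, lam n *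
        ∫ x in G.face e n, ⟪bilinField (boxMid a b) A B C E x, G.normal e n⟫ ∂μHE[2 - 1] =
      ∑ i, (b (1 - i) - a (1 - i)) * (lam (hi i) * (A i + B i * ((b i - a i) / 2)) -
        lam (lo i) * (A i - B i * ((b i - a i) / 2))) := by
  rw [h.sum_nodesOf]
  refine Finset.sum_congr rfl fun i _ => ?_
  rw [h.integral_lo, h.integral_hi]
  ring

/-- The flux on a rectangle is of Raviart–Thomas type for all choices of the flux space. -/
theorem IsRect.exists_eq_bilinField (h : IsRect G e a b lo hi) (hk : 0 < k)
    (hRT : RT0Rect 2 ≤ Q) (hQ : Q ≤ vec (Q1 2))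
    (hs : LocalSolution G e (P0 (Euc 2)) Q τ (fun _ => k) f u q lam) :
    ∃ u₀ A B, u = (fun _ => u₀) ∧ q = bilinField (boxMid a b) A B 0 0 := by
  obtain ⟨u₀, hu⟩ := hs.u_mem
  obtain rfl : u = fun _ => u₀ := funext hu
  obtain ⟨A, B, C, E, rfl⟩ := HDG.exists_eq_bilinField (boxMid a b) (hQ hs.q_mem)
  -- The part of the flux outside `RT0Rect 2` is itself an admissible test field. Its divergence and
  -- its normal component on each side have zero mean, so against constant `u` and `lam` only its
  -- own weighted `L²` norm remains.
  have hr : bilinField (boxMid a b) 0 0 C E ∈ Q := by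
    have : bilinField (boxMid a b) 0 0 C E =
        bilinField (boxMid a b) A B C E - bilinField (boxMid a b) A B 0 0 := by
      funext x
      ext i
      simp [bilinField]
      ring
    rw [this]
    exact Q.sub_mem hs.q_mem (hRT (bilinField_mem_RT0 _ _ _))
  have hp := hs.primary _ hr
  rw [h.dom, integral_inner_bilinField h.lt, integral_divergence_bilinField h.lt,
    h.sum_inner_normal] at hp
  have h0 := sub_pos.2 (h.lt 0)
  have h1 := sub_pos.2 (h.lt 1)
  simp [Fin.sum_univ_two, hk.ne', h0.ne', h1.ne'] at hp
  refine ⟨u₀, A, B, rfl, ?_⟩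
  have hz : C 0 = 0 ∧ E 0 = 0 ∧ C 1 = 0 ∧ E 1 = 0 := by
    have p1 : 0 < (b 1 - a 1) ^ 2 / 12 := by positivity
    have p0 : 0 < (b 0 - a 0) ^ 2 / 12 := by positivity
    have p2 : 0 < (b 0 - a 0) ^ 2 * (b 1 - a 1) ^ 2 / 144 := by positivity
    have n1 := mul_nonneg (mul_self_nonneg (C 0)) p1.le
    have n2 := mul_nonneg (mul_self_nonneg (C 1)) p0.le
    have n3 := mul_nonneg (mul_self_nonneg (E 0)) p2.le
    have n4 := mul_nonneg (mul_self_nonneg (E 1)) p2.le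
    have z : ∀ x y : ℝ, 0 < y → x * x * y = 0 → x = 0 := fun x y hy hxy =>
      mul_self_eq_zero.1 ((mul_eq_zero.1 hxy).resolve_right hy.ne')
    exact ⟨z _ _ p1 (by linarith), z _ _ p2 (by linarith), z _ _ p0 (by linarith),
      z _ _ p2 (by linarith)⟩
  have hCz : C = 0 := by ext i; fin_cases i; exacts [hz.1, hz.2.2.1]
  have hEz : E = 0 := by ext i; fin_cases i; exacts [hz.2.1, hz.2.2.2]
  rw [hCz, hEz]

/-- The extra components of a test field are orthogonal to Raviart–Thomas fluxes and invisible to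
constant `u` and `lam`, so testing with `RT0Rect 2` is enough. -/
theorem IsRect.localSolution_congr (h : IsRect G e a b lo hi) (hk : 0 < k)
    (hRT : RT0Rect 2 ≤ Q) (hQ : Q ≤ vec (Q1 2)) (hRT' : RT0Rect 2 ≤ Q') (hQ' : Q' ≤ vec (Q1 2))
    (hs : LocalSolution G e (P0 (Euc 2)) Q τ (fun _ => k) f u q lam) :
    LocalSolution G e (P0 (Euc 2)) Q' τ (fun _ => k) f u q lam := by
  obtain ⟨u₀, A, B, rfl, rfl⟩ := h.exists_eq_bilinField hk hRT hQ hs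
  refine ⟨hs.u_mem, hRT' (bilinField_mem_RT0 _ _ _), fun p hp => ?_, hs.flux⟩
  obtain ⟨A', B', C', E', rfl⟩ := HDG.exists_eq_bilinField (boxMid a b) (hQ' hp)
  have hp₀ := hs.primary _ (hRT (bilinField_mem_RT0 (boxMid a b) A' B'))
  rw [h.dom, integral_inner_bilinField h.lt, integral_divergence_bilinField h.lt,
    h.sum_inner_normal] at hp₀ ⊢
  simpa only [Pi.zero_apply, zero_mul, mul_zero] using hp₀

theorem IsRect.coefficients (h : IsRect G e a b lo hi) (hk : 0 < k)
    (hRT : RT0Rect 2 ≤ Q) (hQ : Q ≤ vec (Q1 2))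
    (hs : LocalSolution G e (P0 (Euc 2)) Q τ (fun _ => k) f u q lam) :
    ∃ u₀, (∀ x, u x = u₀) ∧
      (∀ i, numFlux G e τ u q lam (lo i) = (b (1 - i) - a (1 - i)) *
        (k / (b i - a i) * (lam (hi i) - lam (lo i)) +
          6 * k / (b i - a i) * (u₀ - (lam (lo i) + lam (hi i)) / 2) + τ * (u₀ - lam (lo i)))) ∧
      (∀ i, numFlux G e τ u q lam (hi i) = (b (1 - i) - a (1 - i)) *
        (k / (b i - a i) * (lam (lo i) - lam (hi i)) +
          6 * k / (b i - a i) * (u₀ - (lam (lo i) + lam (hi i)) / 2) + τ * (u₀ - lam (hi i)))) ∧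
      ∑ i, 2 * (b (1 - i) - a (1 - i)) * (6 * k / (b i - a i) + τ) *
        (u₀ - (lam (lo i) + lam (hi i)) / 2) = ∫ x in G.dom e, f x := by
  obtain ⟨u₀, A, B, rfl, rfl⟩ := h.exists_eq_bilinField hk hRT hQ hs
  have hl : ∀ i, 0 < b i - a i := fun i => sub_pos.2 (h.lt i)
  have hA : ∀ i, A i = -(k / (b i - a i) * (lam (hi i) - lam (lo i))) := by
    intro i
    have hp := hs.primary _ (hRT (bilinField_mem_RT0 (boxMid a b) (Pi.single i 1) 0))
    rw [h.dom, integral_inner_bilinField h.lt, integral_divergence_bilinField h.lt,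
      h.sum_inner_normal] at hp
    have h0 := hl 0
    have h1 := hl 1
    fin_cases i <;> simp [Fin.sum_univ_two, Pi.single_apply] at hp ⊢ <;> field_simp at hp ⊢ <;>
      linarith
  have hB : ∀ i, B i * ((b i - a i) / 2) =
      6 * k / (b i - a i) * (u₀ - (lam (lo i) + lam (hi i)) / 2) := by
    intro i
    have hp := hs.primary _ (hRT (bilinField_mem_RT0 (boxMid a b) 0 (Pi.single i 1)))
    rw [h.dom, integral_inner_bilinField h.lt, integral_divergence_bilinField h.lt,
      h.sum_inner_normal] at hp
    have h0 := hl 0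
    have h1 := hl 1
    fin_cases i <;> simp [Fin.sum_univ_two, Pi.single_apply] at hp ⊢ <;> field_simp at hp ⊢ <;>
      linarith
  refine ⟨u₀, fun _ => rfl, fun i => ?_, fun i => ?_, ?_⟩
  · have : numFlux G e τ (fun _ => u₀) (bilinField (boxMid a b) A B 0 0) lam (lo i) =
        ∫ x in G.face e (lo i), ⟪bilinField (boxMid a b) (fun j => A j - τ * (u₀ - lam (lo i))) B 0 0
          x, G.normal e (lo i)⟫ ∂μHE[2 - 1] := by
      refine integral_congr_ae (.of_forall fun x => ?_)
      simp [h.normal_lo, EuclideanSpace.inner_single_right, bilinField]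
      ring
    rw [this, h.integral_lo, hA, hB]
    ring
  · have : numFlux G e τ (fun _ => u₀) (bilinField (boxMid a b) A B 0 0) lam (hi i) =
        ∫ x in G.face e (hi i), ⟪bilinField (boxMid a b) (fun j => A j + τ * (u₀ - lam (hi i))) B 0 0
          x, G.normal e (hi i)⟫ ∂μHE[2 - 1] := by
      refine integral_congr_ae (.of_forall fun x => ?_)
      simp [h.normal_hi, EuclideanSpace.inner_single_right, bilinField]
      ring
    rw [this, h.integral_hi, hA, hB]
    ring
  · have hv := hs.flux (fun _ => 1) ⟨1, fun _ => rfl⟩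
    have hdiv := integral_divergence_bilinField h.lt 1 A B 0 0
    simp only [one_mul, ← h.dom] at hdiv
    rw [h.sum_nodesOf, h.sum_nodesOf] at hv
    simp only [h.integral_const_lo, h.integral_const_hi, one_mul, mul_one, hdiv] at hv
    have hB' : ∀ i, B i = 12 * k / (b i - a i) ^ 2 * (u₀ - (lam (lo i) + lam (hi i)) / 2) := by
      intro i
      have h1 := hl i
      have h2 := hB i
      field_simp at h2 ⊢
      linarith
    rw [Fin.sum_univ_two] at hv ⊢
    rw [hB', hB'] at hv
    simp only [Fin.sum_univ_two, sub_zero, sub_self] at hv ⊢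
    have h0 := hl 0
    have h1 := hl 1
    generalize ∫ x in G.dom e, f x = F at *
    have e0 : (b 0 - a 0) * (b 1 - a 1) * (12 * k / (b 0 - a 0) ^ 2 *
        (u₀ - (lam (lo 0) + lam (hi 0)) / 2)) = 2 * (b 1 - a 1) * (6 * k / (b 0 - a 0)) *
        (u₀ - (lam (lo 0) + lam (hi 0)) / 2) := by field_simp; ring
    have e1 : (b 0 - a 0) * (b 1 - a 1) * (12 * k / (b 1 - a 1) ^ 2 *
        (u₀ - (lam (lo 1) + lam (hi 1)) / 2)) = 2 * (b 0 - a 0) * (6 * k / (b 1 - a 1)) *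
        (u₀ - (lam (lo 1) + lam (hi 1)) / 2) := by field_simp; ring
    rw [mul_add ((b 0 - a 0) * (b 1 - a 1)), e0, e1] at hv
    linarith

/-- The stabilization parameter is large enough for the local matrix on a rectangle with side
lengths `s` and `t` to have nonpositive off-diagonal entries. -/
def StabilizationBound (s t k τ : ℝ) : Prop :=
  4 * (k / s) * (t * (6 * k / s + τ) + s * (6 * k / t + τ)) ≤ t * (6 * k / s + τ) ^ 2

/-- Each of the two summands on the left is bounded by half of the right side, using `τ ≤ 6 * k / s
+ τ`. -/
theorem stabilizationBound_of_le {s t k τ : ℝ} (hs : 0 < s) (ht : 0 < t) (hk : 0 < k)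
    (h₁ : 8 * k ≤ τ * s) (h₂ : 8 * k * (s + t) ≤ τ * t ^ 2) : StabilizationBound s t k τ := by
  have hτ : 0 < τ := pos_of_mul_pos_left (by linarith : 0 < τ * s) hs.le
  set α := 6 * k / s + τ with hα
  have hατ : τ ≤ α := by
    have : 0 ≤ 6 * k / s := by positivity
    linarith
  have hks : 8 * (k / s) ≤ τ := by
    rw [← mul_div_assoc, div_le_iff₀ hs]
    exact h₁
  have e1 : 4 * (k / s) * (t * α) ≤ t * α ^ 2 / 2 := by
    have : 8 * (k / s) ≤ α := hks.trans hατ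
    nlinarith [mul_le_mul_of_nonneg_left this (mul_pos ht (hτ.trans_le hατ)).le]
  have e2 : 4 * (k / s) * (s * (6 * k / t + τ)) = 24 * k ^ 2 / t + 4 * k * τ := by
    field_simp
    ring
  have e3 : 24 * k ^ 2 / t + 4 * k * τ ≤ t * τ ^ 2 / 2 := by
    rw [← mul_le_mul_iff_left₀ ht]
    have : (24 * k ^ 2 / t + 4 * k * τ) * t = 24 * k ^ 2 + 4 * k * τ * t := by field_simp
    rw [this]
    have h3 := mul_le_mul_of_nonneg_left h₂ hτ.le
    have h4 := mul_le_mul_of_nonneg_left h₁ hk.le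
    nlinarith
  have e4 : t * τ ^ 2 / 2 ≤ t * α ^ 2 / 2 := by gcongr
  unfold StabilizationBound
  rw [← hα, mul_add, e2]
  linarith

/-- For equal sides both summands coincide, and the bound reduces to `8 * (k / s) ≤ 6 * k / s + τ`.
-/
theorem stabilizationBound_square {s k τ : ℝ} (hs : 0 < s) (hk : 0 < k) (hτ : 0 < τ)
    (h : 2 * k ≤ τ * s) : StabilizationBound s s k τ := by
  have h1 : 8 * (k / s) ≤ 6 * k / s + τ := by
    rw [← sub_nonneg]
    have : 6 * k / s + τ - 8 * (k / s) = (τ * s - 2 * k) / s := by field_simp; ring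
    rw [this]
    exact div_nonneg (by linarith) hs.le
  have h2 : 0 < s * (6 * k / s + τ) := by positivity
  unfold StabilizationBound
  nlinarith [mul_le_mul_of_nonneg_left h1 h2.le]

theorem IsRect.localMonotone (h : IsRect G e a b lo hi) {Φ : ν → ℝ} {r : Fin 2 → ℝ} {c : Fin 2 → ℝ}
    {g : ℝ} (hg : 0 < g) (hc : ∀ i, 0 ≤ c i) (hr : ∀ i, 0 ≤ r i)
    (hlo : ∀ i, Φ (lo i) = c i * (lam (hi i) - lam (lo i)) +
      g * (lam (lo (1 - i)) - lam (lo i) + (lam (hi (1 - i)) - lam (lo i))) + r i)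
    (hhi : ∀ i, Φ (hi i) = c i * (lam (lo i) - lam (hi i)) +
      g * (lam (lo (1 - i)) - lam (hi i) + (lam (hi (1 - i)) - lam (hi i))) + r i) :
    LocalMonotone G e lam Φ := by
  set m : ν → ℝ := fun n => max (-lam n) 0 with hm
  have hm0 : ∀ n, 0 ≤ m n := fun n => le_max_right _ _
  have key : ∀ n n', (m n - m n') ^ 2 ≤ (m n - m n') * (lam n' - lam n) :=
    fun n n' => sq_negPart_sub_le _ _
  -- Adjacent sides form a 4-cycle of conductances `g > 0`, which already connects all four sides.
  -- Hence the conductances between opposite sides need only be nonnegative and can be dropped.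
  have hsum : g * ((m (lo 0) - m (lo 1)) ^ 2 + (m (lo 0) - m (hi 1)) ^ 2 +
      (m (hi 0) - m (lo 1)) ^ 2 + (m (hi 0) - m (hi 1)) ^ 2) ≤
      ∑ n ∈ nodesOf G e, m n * Φ n := by
    rw [h.sum_nodesOf, Fin.sum_univ_two, hlo, hlo, hhi, hhi]
    simp only [sub_zero, sub_self]
    have k1 := mul_le_mul_of_nonneg_left (key (lo 0) (lo 1)) hg.le
    have k2 := mul_le_mul_of_nonneg_left (key (lo 0) (hi 1)) hg.le
    have k3 := mul_le_mul_of_nonneg_left (key (hi 0) (lo 1)) hg.le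
    have k4 := mul_le_mul_of_nonneg_left (key (hi 0) (hi 1)) hg.le
    have k5 := mul_nonneg (hc 0) ((sq_nonneg _).trans (key (lo 0) (hi 0)))
    have k6 := mul_nonneg (hc 1) ((sq_nonneg _).trans (key (lo 1) (hi 1)))
    have r1 := mul_nonneg (hm0 (lo 0)) (hr 0)
    have r2 := mul_nonneg (hm0 (hi 0)) (hr 0)
    have r3 := mul_nonneg (hm0 (lo 1)) (hr 1)
    have r4 := mul_nonneg (hm0 (hi 1)) (hr 1)
    linarith
  refine ⟨le_trans (by positivity) hsum, fun h0 => ?_⟩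
  have h0' : ∑ n ∈ nodesOf G e, m n * Φ n = 0 := h0
  rw [h0'] at hsum
  have hle : (m (lo 0) - m (lo 1)) ^ 2 + (m (lo 0) - m (hi 1)) ^ 2 +
      (m (hi 0) - m (lo 1)) ^ 2 + (m (hi 0) - m (hi 1)) ^ 2 ≤ 0 := by
    by_contra hcon
    push Not at hcon
    linarith [mul_pos hg hcon]
  have s1 := sq_nonneg (m (lo 0) - m (lo 1))
  have s2 := sq_nonneg (m (lo 0) - m (hi 1))
  have s3 := sq_nonneg (m (hi 0) - m (lo 1))
  have s4 := sq_nonneg (m (hi 0) - m (hi 1))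
  have z : ∀ x y : ℝ, (x - y) ^ 2 = 0 → x = y := fun x y hxy =>
    sub_eq_zero.1 (pow_eq_zero_iff two_ne_zero |>.1 hxy)
  have e1 := z _ _ (by linarith : (m (lo 0) - m (lo 1)) ^ 2 = 0)
  have e2 := z _ _ (by linarith : (m (lo 0) - m (hi 1)) ^ 2 = 0)
  have e3 := z _ _ (by linarith : (m (hi 0) - m (lo 1)) ^ 2 = 0)
  have hall : ∀ n, G.Incident e n → m n = m (lo 0) := by
    intro n hn
    obtain ⟨i, hi⟩ := (h.incident n).1 hn
    fin_cases i <;> rcases hi with rfl | rfl <;> simp <;> linarith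
  intro n₀ hn₀ hl n hn
  have hmn : m n = 0 := by
    rw [hall n hn, ← hall n₀ hn₀]
    simpa [hm] using hl
  simpa [hm] using hmn

theorem IsRect.maximumPrinciple (h : IsRect G e a b lo hi) (hτ : 0 < τ) (hk : 0 < k)
    (hRT : RT0Rect 2 ≤ Q) (hQ : Q ≤ vec (Q1 2))
    (hs : LocalSolution G e (P0 (Euc 2)) Q τ (fun _ => k) f u q lam)
    (hf : 0 ≤ ∫ x in G.dom e, f x)
    (hstab : ∀ i, StabilizationBound (b i - a i) (b (1 - i) - a (1 - i)) k τ) :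
    LocalMonotone G e lam (numFlux G e τ u q lam) ∧
      ((∀ n, 0 ≤ lam n) → ∀ x ∈ G.dom e, 0 ≤ u x) := by
  obtain ⟨u₀, hu, hlo, hhi, hflux⟩ := h.coefficients hk hRT hQ hs
  set F := ∫ x in G.dom e, f x
  let s : Fin 2 → ℝ := fun i => b i - a i
  have hl : ∀ i, 0 < s i := fun i => sub_pos.2 (h.lt i)
  let α : Fin 2 → ℝ := fun i => 6 * k / s i + τ
  have hα : ∀ i, 0 < α i := fun i => by have := hl i; positivity
  let y : Fin 2 → ℝ := fun i => (lam (lo i) + lam (hi i)) / 2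
  let W : ℝ := s 1 * α 0 + s 0 * α 1
  have hW : 0 < W := add_pos (mul_pos (hl 1) (hα 0)) (mul_pos (hl 0) (hα 1))
  have hWi : ∀ i, s (1 - i) * α i + s i * α (1 - i) = W := by
    intro i
    fin_cases i
    · rfl
    · exact add_comm _ _
  have hflux' : ∀ i, 2 * s (1 - i) * α i * (u₀ - y i) +
      2 * s i * α (1 - i) * (u₀ - y (1 - i)) = F := by
    intro i
    rw [← hflux, Fin.sum_univ_two]
    fin_cases i
    · rfl
    · exact add_comm _ _
  -- The flux equation makes `u₀` a convex combination of the two means `y i` of opposite sides,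
  -- shifted by `F / (2 * W)`.
  have hu₀ : ∀ i, u₀ - y i = (s i * α (1 - i) * (y (1 - i) - y i) + F / 2) / W := by
    intro i
    rw [eq_div_iff hW.ne', ← hWi i]
    linarith [hflux' i]
  constructor
  -- Expanding `y (1 - i) - y i` in differences to one fixed side gives `g` for each adjacent side
  -- and takes `g` away from the opposite one. The subtraction is the reason for a lower bound on
  -- `τ`.
  · refine h.localMonotone (g := s 0 * s 1 * α 0 * α 1 / W / 2)
      (c := fun i => s (1 - i) * (k / s i + τ / 2) - s 0 * s 1 * α 0 * α 1 / W / 2)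
      (r := fun i => s (1 - i) * α i * (F / 2) / W) ?_ ?_ ?_ ?_ ?_
    · have := hl 0; have := hl 1; have := hα 0; have := hα 1
      positivity
    · intro i
      -- This inequality is equivalent to nonnegativity of `c i`.
      have hst : 4 * (k / s i) * W ≤ s (1 - i) * α i ^ 2 := by
        rw [← hWi i]; exact hstab i
      have hprod : s 0 * s 1 * α 0 * α 1 = s i * s (1 - i) * α i * α (1 - i) := by
        fin_cases i
        · rfl
        · simp; ring
      have hsα : s i * α (1 - i) = W - s (1 - i) * α i := by rw [← hWi i]; ring
      have hW' : s 0 * s 1 * α 0 * α 1 / W = s (1 - i) * (α i - s (1 - i) * α i ^ 2 / W) := by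
        rw [hprod]
        field_simp
        linear_combination (s (1 - i) * α i) * hsα
      have h3 : 4 * (k / s i) ≤ s (1 - i) * α i ^ 2 / W := by rwa [le_div_iff₀ hW]
      have h4 : k / s i + τ / 2 - (α i - s (1 - i) * α i ^ 2 / W) / 2 =
          (s (1 - i) * α i ^ 2 / W - 4 * (k / s i)) / 2 := by
        simp only [α]; ring
      have h5 : 0 ≤ s (1 - i) * (k / s i + τ / 2 - (α i - s (1 - i) * α i ^ 2 / W) / 2) := by
        rw [h4]
        exact mul_nonneg (hl _).le (by linarith)
      simp only [hW']
      linarith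
    · intro i
      have := hl (1 - i); have := hα i
      positivity
    · intro i
      have hprod : s 0 * s 1 * α 0 * α 1 = s i * s (1 - i) * α i * α (1 - i) := by
        fin_cases i
        · rfl
        · simp; ring
      have e1 : numFlux G e τ u q lam (lo i) = s (1 - i) * (α i * (u₀ - y i) +
          (k / s i + τ / 2) * (lam (hi i) - lam (lo i))) := by
        rw [hlo]; simp only [α, y, s]; ring
      rw [e1, hu₀, hprod]
      simp only [y]
      ring
    · intro i
      have hprod : s 0 * s 1 * α 0 * α 1 = s i * s (1 - i) * α i * α (1 - i) := by
        fin_cases i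
        · rfl
        · simp; ring
      have e1 : numFlux G e τ u q lam (hi i) = s (1 - i) * (α i * (u₀ - y i) +
          (k / s i + τ / 2) * (lam (lo i) - lam (hi i))) := by
        rw [hhi]; simp only [α, y, s]; ring
      rw [e1, hu₀, hprod]
      simp only [y]
      ring
  · intro hlam x _
    rw [hu]
    have h1 : W * u₀ = s 1 * α 0 * y 0 + s 0 * α 1 * y 1 + F / 2 := by
      have := hflux' 0
      simp only [sub_zero] at this
      simp only [W]
      linarith
    have hy : ∀ i, 0 ≤ y i := fun i => by
      have := hlam (lo i); have := hlam (hi i); positivity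
    refine nonneg_of_mul_nonneg_right ?_ hW
    rw [h1]
    exact add_nonneg (add_nonneg (mul_nonneg (mul_pos (hl 1) (hα 0)).le (hy 0))
      (mul_nonneg (mul_pos (hl 0) (hα 1)).le (hy 1))) (by linarith)

/-! ### Stabilization thresholds in terms of diameter and aspect ratio -/

theorem diam_box_le {a b : Fin 2 → ℝ} (hab : ∀ i, a i < b i) :
    Metric.diam (box a b) ≤ (b 0 - a 0) + (b 1 - a 1) := by
  have h0 := sub_pos.2 (hab 0)
  have h1 := sub_pos.2 (hab 1)
  refine Metric.diam_le_of_forall_dist_le (by linarith) fun x hx y hy => ?_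
  rw [EuclideanSpace.dist_eq, Fin.sum_univ_two]
  have hx0 := hx 0; have hy0 := hy 0; have hx1 := hx 1; have hy1 := hy 1
  have d0 : dist (x 0) (y 0) ≤ b 0 - a 0 := by
    rw [Real.dist_eq, abs_le]; constructor <;> linarith
  have d1 : dist (x 1) (y 1) ≤ b 1 - a 1 := by
    rw [Real.dist_eq, abs_le]; constructor <;> linarith
  refine Real.sqrt_le_iff.2 ⟨by linarith, ?_⟩
  have n0 : 0 ≤ dist (x 0) (y 0) := dist_nonneg
  have n1 : 0 ≤ dist (x 1) (y 1) := dist_nonneg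
  nlinarith

omit [Fintype ν] in
theorem diam_dom_pos (hd : G.dom e = box a b) (hab : ∀ i, a i < b i) :
    0 < Metric.diam (G.dom e) := by
  refine Metric.diam_pos ?_ (G.isBounded_dom e)
  rw [hd]
  refine ⟨WithLp.toLp 2 fun i => (a i + b i) / 2, fun i => ?_,
    WithLp.toLp 2 fun i => (2 * a i + b i) / 3, fun i => ?_, fun heq => ?_⟩
  · have := hab i
    simp only
    constructor <;> linarith
  · have := hab i
    simp only
    constructor <;> linarith
  · have h0 := congrArg (fun x : Euc 2 => x 0) heq
    have := hab 0
    simp only at h0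
    linarith

theorem bounds_of_aspectRatio {s t δ k τ : ℝ} (h0 : 0 < s) (h1 : 0 < t) (hdpos : 0 < δ)
    (hdiam : δ ≤ s + t) (hk : 0 < k) (hτ : 0 < τ)
    (hstab : 8 * (1 + |aspectRatio s t|) ^ 2 * (k / δ) ≤ τ) :
    (8 * k ≤ τ * s ∧ 8 * k * (s + t) ≤ τ * t ^ 2) ∧
      (8 * k ≤ τ * t ∧ 8 * k * (t + s) ≤ τ * s ^ 2) := by
  have hm : 0 < min s t := lt_min h0 h1
  -- With this identity and `δ ≤ s + t`, the hypothesis becomes `8 * k * (s + t) ≤ τ * min s t ^ 2`,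
  -- which implies all four bounds.
  have hasp : 1 + |aspectRatio s t| = (s + t) / min s t := by
    rw [aspectRatio, abs_of_pos (div_pos (h0.trans_le (le_max_left _ _)) hm), eq_div_iff hm.ne',
      add_mul, div_mul_cancel₀ _ hm.ne', one_mul, min_add_max]
  have hmin : 8 * k * (s + t) ≤ τ * min s t ^ 2 := by
    have h2 : 8 * ((s + t) / min s t) ^ 2 * (k / (s + t)) ≤ τ := by
      rw [hasp] at hstab
      refine le_trans ?_ hstab
      gcongr
    have h3 : 8 * ((s + t) / min s t) ^ 2 * (k / (s + t)) = 8 * k * (s + t) / min s t ^ 2 := by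
      field_simp
    rwa [h3, div_le_iff₀ (by positivity)] at h2
  have hs2 : 8 * k * (s + t) ≤ τ * s ^ 2 := by
    refine hmin.trans ?_
    gcongr
    exact min_le_left _ _
  have ht2 : 8 * k * (s + t) ≤ τ * t ^ 2 := by
    refine hmin.trans ?_
    gcongr
    exact min_le_right _ _
  have hs1 : 8 * k ≤ τ * s :=
    le_of_mul_le_mul_right (by nlinarith [mul_pos (mul_pos hτ h0) h1]) (add_pos h0 h1)
  have ht1 : 8 * k ≤ τ * t :=
    le_of_mul_le_mul_right (by nlinarith [mul_pos (mul_pos hτ h0) h1]) (add_pos h0 h1)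
  exact ⟨⟨hs1, ht2⟩, ht1, by rwa [add_comm t s]⟩

omit [Fintype ν] in
theorem IsRect.stabilizationBound (h : IsRect G e a b lo hi) (hτ : 0 < τ) (hk : 0 < k)
    (hstab : 8 * (1 + |aspectRatio (b 0 - a 0) (b 1 - a 1)|) ^ 2 *
        (k / Metric.diam (G.dom e)) ≤ τ ∨
      (b 0 - a 0 = b 1 - a 1 ∧ 2 * k / (b 0 - a 0) ≤ τ)) (i : Fin 2) :
    StabilizationBound (b i - a i) (b (1 - i) - a (1 - i)) k τ := by
  have h0 := sub_pos.2 (h.lt 0)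
  have h1 := sub_pos.2 (h.lt 1)
  have hdiam := h.dom ▸ diam_box_le h.lt
  have hdpos := diam_dom_pos h.dom h.lt
  rcases hstab with hstab | ⟨hsq, hstab⟩
  · obtain ⟨⟨c1, c2⟩, c3, c4⟩ := bounds_of_aspectRatio h0 h1 hdpos hdiam hk hτ hstab
    fin_cases i
    · exact stabilizationBound_of_le h0 h1 hk c1 c2
    · exact stabilizationBound_of_le h1 h0 hk c3 c4
  · rw [div_le_iff₀ h0] at hstab
    fin_cases i
    · simp only [Fin.zero_eta, sub_zero, ← hsq]
      exact stabilizationBound_square h0 hk hτ hstab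
    · simp only [Fin.mk_one, sub_self, ← hsq]
      exact stabilizationBound_square h0 hk hτ hstab

end HDG

end

noncomputable section

namespace HDG

open PolyhedralHypergraph

/-! ### Consequences for HDG solutions -/

variable {d D : ℕ} {ι ν : Type*} {G : PolyhedralHypergraph d D ι ν}

theorem IsAdmissible.integral_source_nonneg {M : ν → Submodule ℝ (Euc D → ℝ)} {ΓD : Set ν}
    {f : ι → Euc d → ℝ} {g : ν → Euc D → ℝ} (h : IsAdmissible G M ΓD f g) (e : ι) :
    0 ≤ ∫ x in G.dom e, f e x :=
  integral_nonneg_of_ae (h.source_nonneg e)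

theorem bdryIntegral_one [Fintype ν] (e : ι) :
    G.bdryIntegral e (fun _ _ => 1) = ∑ n ∈ nodesOf G e, G.area e n := by
  simp [bdryIntegral_eq, area]

variable [Fintype ι] [Fintype ν]
  {U : ι → Submodule ℝ (Euc d → ℝ)} {Q Q' : ι → Submodule ℝ (Euc d → Euc d)}
  {M : ν → Submodule ℝ (Euc D → ℝ)} {τ : ι → ℝ} {κ f : ι → Euc d → ℝ} {ΓD : Set ν}
  {g : ν → Euc D → ℝ} {u : ι → Euc d → ℝ} {q : ι → Euc d → Euc d} {lam : ν → ℝ}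

theorem IsHDGSolution.of_localSolution
    (h : IsHDGSolution G U Q M τ κ f ΓD g u q fun n _ => lam n)
    (hloc : ∀ e, LocalSolution G e (U e) (Q' e) (τ e) (κ e) (f e) (u e) (q e) lam) :
    IsHDGSolution G U Q' M τ κ f ΓD g u q fun n _ => lam n where
  u_mem := h.u_mem
  q_mem e := (hloc e).q_mem
  l_mem := h.l_mem
  dirichlet := h.dirichlet
  primary e p hp := by
    simpa only [bdryIntegral_eq, integral_const_mul] using (hloc e).primary p hp
  flux := h.flux
  conservation := h.conservation

theorem RT0Rect_le_and_le_Q1 {Q : Submodule ℝ (Euc 2 → Euc 2)}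
    (h : Q = vec (Q1 2) ∨ Q = vec (P1 2) ∨ Q = RT0Rect 2) :
    RT0Rect 2 ≤ Q ∧ Q ≤ vec (Q1 2) := by
  rcases h with rfl | rfl | rfl
  · exact ⟨RT0Rect_le_P1.trans P1_le_Q1, le_rfl⟩
  · exact ⟨RT0Rect_le_P1, P1_le_Q1⟩
  · exact ⟨le_rfl, RT0Rect_le_P1.trans P1_le_Q1⟩

theorem IsHDGSolution.rect_congr {D : ℕ} {ι ν : Type*} [Fintype ι] [Fintype ν]
    {G : PolyhedralHypergraph 2 D ι ν} {a b : ι → Fin 2 → ℝ} {τ k : ι → ℝ} {ΓD : Set ν}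
    {f : ι → Euc 2 → ℝ} {g : ν → Euc D → ℝ} {Q Q' : ι → Submodule ℝ (Euc 2 → Euc 2)}
    {u : ι → Euc 2 → ℝ} {q : ι → Euc 2 → Euc 2} {l : ν → Euc D → ℝ}
    (hrect : ∀ e, G.IsRectangle e (a e) (b e)) (hk : ∀ e, 0 < k e)
    (hQ : ∀ e, Q e = vec (Q1 2) ∨ Q e = vec (P1 2) ∨ Q e = RT0Rect 2)
    (hQ' : ∀ e, Q' e = vec (Q1 2) ∨ Q' e = vec (P1 2) ∨ Q' e = RT0Rect 2)
    (h : IsHDGSolution G (fun _ => P0 (Euc 2)) Q (fun _ => P0 (Euc D)) τ (fun e _ => k e) f ΓD g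
      u q l) :
    IsHDGSolution G (fun _ => P0 (Euc 2)) Q' (fun _ => P0 (Euc D)) τ (fun e _ => k e) f ΓD g
      u q l := by
  obtain ⟨lam, rfl⟩ := exists_eq_const h.l_mem
  refine h.of_localSolution fun e => ?_
  obtain ⟨lo, hi, hr⟩ := (hrect e).exists_isRect
  obtain ⟨h1, h2⟩ := RT0Rect_le_and_le_Q1 (hQ e)
  obtain ⟨h3, h4⟩ := RT0Rect_le_and_le_Q1 (hQ' e)
  exact hr.localSolution_congr (hk e) h1 h2 h3 h4 (h.localSolution e)

end HDG

end

/-! ### The main theorem -/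

theorem theorem2p2 :
    -- graphs, `U = P_1`, `Q = P_1`
    (∀ {D : ℕ} {ι ν : Type*} [Fintype ι] [Fintype ν] (G : HDG.PolyhedralHypergraph 1 D ι ν)
      (τ k : ι → ℝ) (ΓD : Set ν) (f : ι → HDG.Euc 1 → ℝ) (g : ν → HDG.Euc D → ℝ)
      (u : ι → HDG.Euc 1 → ℝ) (q : ι → HDG.Euc 1 → HDG.Euc 1) (l : ν → HDG.Euc D → ℝ),
      (∀ e, 0 < τ e) → (∀ e, 0 < k e) →
      HDG.IsAdmissible G (fun _ => HDG.P0 (HDG.Euc D)) ΓD f g →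
      HDG.IsHDGSolution G (fun _ => HDG.P1 1) (fun _ => HDG.vec (HDG.P1 1))
        (fun _ => HDG.P0 (HDG.Euc D)) τ (fun e _ => k e) f ΓD g u q l →
      HDG.SkeletonNonneg G l ∧ (∀ e, 0 ≤ ⨍ x in G.dom e, u e x) ∧
      ((∀ e, ∃ c : ℝ, ∀ᵐ x ∂(volume.restrict (G.dom e)), f e x = c) → HDG.BulkNonneg G u)) ∧
    -- graphs, remaining combinations of `P_0` and `P_1`, chosen on each edge independently
    (∀ {D : ℕ} {ι ν : Type*} [Fintype ι] [Fintype ν] (G : HDG.PolyhedralHypergraph 1 D ι ν)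
      (U : ι → Submodule ℝ (HDG.Euc 1 → ℝ)) (Q : ι → Submodule ℝ (HDG.Euc 1 → HDG.Euc 1))
      (τ k : ι → ℝ) (ΓD : Set ν) (f : ι → HDG.Euc 1 → ℝ) (g : ν → HDG.Euc D → ℝ)
      (u : ι → HDG.Euc 1 → ℝ) (q : ι → HDG.Euc 1 → HDG.Euc 1) (l : ν → HDG.Euc D → ℝ),
      (∀ e, 0 < τ e) → (∀ e, 0 < k e) →
      (∀ e, (U e = HDG.P1 1 ∧ Q e = HDG.vec (HDG.P0 (HDG.Euc 1))) ∨
        (U e = HDG.P0 (HDG.Euc 1) ∧ Q e = HDG.vec (HDG.P1 1)) ∨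
        (U e = HDG.P0 (HDG.Euc 1) ∧ Q e = HDG.vec (HDG.P0 (HDG.Euc 1)))) →
      HDG.IsAdmissible G (fun _ => HDG.P0 (HDG.Euc D)) ΓD f g →
      HDG.IsHDGSolution G U Q (fun _ => HDG.P0 (HDG.Euc D)) τ (fun e _ => k e) f ΓD g u q l →
      HDG.BulkNonneg G u ∧ HDG.SkeletonNonneg G l) ∧
    -- LDG-H on hypergraphs and domains
    (∀ {d D : ℕ} {ι ν : Type*} [Fintype ι] [Fintype ν] (G : HDG.PolyhedralHypergraph d D ι ν)
      (τ : ι → ℝ) (κ : ι → HDG.Euc d → ℝ) (ΓD : Set ν) (f : ι → HDG.Euc d → ℝ)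
      (g : ν → HDG.Euc D → ℝ)
      (u : ι → HDG.Euc d → ℝ) (q : ι → HDG.Euc d → HDG.Euc d) (l : ν → HDG.Euc D → ℝ),
      2 ≤ d → (∀ e, 0 < τ e) → HDG.IsDiffusionCoefficient G κ →
      (∀ e, HDG.NonobtuseAt G e ∨
        G.bdryIntegral e (fun _ _ => 1) / (∫ x in G.dom e, (κ e x)⁻¹) ≤ τ e) →
      HDG.IsAdmissible G (fun _ => HDG.P0 (HDG.Euc D)) ΓD f g →
      HDG.IsHDGSolution G (fun _ => HDG.P0 (HDG.Euc d)) (fun _ => HDG.vec (HDG.P0 (HDG.Euc d)))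
        (fun _ => HDG.P0 (HDG.Euc D)) τ κ f ΓD g u q l →
      HDG.SkeletonNonneg G l ∧ HDG.BulkNonneg G u) ∧
    -- RT-H on simplices
    (∀ {d D : ℕ} {ι ν : Type*} [Fintype ι] [Fintype ν] (G : HDG.PolyhedralHypergraph d D ι ν)
      (k : ι → ℝ) (ΓD : Set ν) (f : ι → HDG.Euc d → ℝ) (g : ν → HDG.Euc D → ℝ)
      (u : ι → HDG.Euc d → ℝ) (q : ι → HDG.Euc d → HDG.Euc d) (l : ν → HDG.Euc D → ℝ),
      2 ≤ d → (∀ e, G.IsSimplex e) → (∀ e, 0 < k e) → (∀ e, HDG.NonobtuseAt G e) →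
      HDG.IsAdmissible G (fun _ => HDG.P0 (HDG.Euc D)) ΓD f g →
      HDG.IsHDGSolution G (fun _ => HDG.P0 (HDG.Euc d)) (fun _ => HDG.RT0Simplex d)
        (fun _ => HDG.P0 (HDG.Euc D)) (fun _ => 0) (fun e _ => k e) f ΓD g u q l →
      HDG.SkeletonNonneg G l ∧ HDG.BulkNonneg G u) ∧
    -- rectangles
    (∃ C : ℝ → ℝ, (∀ ρ, 0 < C ρ) ∧
      ∀ {D : ℕ} {ι ν : Type*} [Fintype ι] [Fintype ν] (G : HDG.PolyhedralHypergraph 2 D ι ν)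
      (a b : ι → Fin 2 → ℝ) (τ k : ι → ℝ) (ΓD : Set ν) (f : ι → HDG.Euc 2 → ℝ)
      (g : ν → HDG.Euc D → ℝ) (Q : ι → Submodule ℝ (HDG.Euc 2 → HDG.Euc 2))
      (u : ι → HDG.Euc 2 → ℝ) (q : ι → HDG.Euc 2 → HDG.Euc 2) (l : ν → HDG.Euc D → ℝ),
      (∀ e, G.IsRectangle e (a e) (b e)) → (∀ e, 0 < τ e) → (∀ e, 0 < k e) →
      (∀ e, Q e = HDG.vec (HDG.Q1 2) ∨ Q e = HDG.vec (HDG.P1 2) ∨ Q e = HDG.RT0Rect 2) →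
      HDG.IsAdmissible G (fun _ => HDG.P0 (HDG.Euc D)) ΓD f g →
      (∀ Q' : ι → Submodule ℝ (HDG.Euc 2 → HDG.Euc 2),
        (∀ e, Q' e = HDG.vec (HDG.Q1 2) ∨ Q' e = HDG.vec (HDG.P1 2) ∨ Q' e = HDG.RT0Rect 2) →
        (HDG.IsHDGSolution G (fun _ => HDG.P0 (HDG.Euc 2)) Q (fun _ => HDG.P0 (HDG.Euc D)) τ
            (fun e _ => k e) f ΓD g u q l ↔
          HDG.IsHDGSolution G (fun _ => HDG.P0 (HDG.Euc 2)) Q' (fun _ => HDG.P0 (HDG.Euc D)) τ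
            (fun e _ => k e) f ΓD g u q l)) ∧
      ((∀ e, C (HDG.aspectRatio (b e 0 - a e 0) (b e 1 - a e 1)) *
            (k e / Metric.diam (G.dom e)) ≤ τ e ∨
          (b e 0 - a e 0 = b e 1 - a e 1 ∧ 2 * k e / (b e 0 - a e 0) ≤ τ e)) →
        HDG.IsHDGSolution G (fun _ => HDG.P0 (HDG.Euc 2)) Q (fun _ => HDG.P0 (HDG.Euc D)) τ
          (fun e _ => k e) f ΓD g u q l →
        HDG.SkeletonNonneg G l ∧ HDG.BulkNonneg G u)) := by
  refine ⟨?_, ?_, ?_, ?_, ?_⟩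
  · intro D ι ν _ _ G τ k ΓD f g u q l hτ hk hadm hsol
    obtain ⟨lam, rfl⟩ := HDG.exists_eq_const hsol.l_mem
    choose a b n₀ n₁ hedge using G.exists_isEdge
    have hloc := fun e =>
      (hedge e).P1_P1 (hτ e) (hk e) (hadm.source_nonneg e) (hsol.localSolution e)
    have hlam := hsol.nonneg_of_localMonotone hadm fun e => (hloc e).1
    exact ⟨fun n _ _ => hlam n, fun e => ((hloc e).2 hlam).1,
      fun hc e => ((hloc e).2 hlam).2 (hc e)⟩
  · intro D ι ν _ _ G U Q τ k ΓD f g u q l hτ hk hUQ hadm hsol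
    obtain ⟨lam, rfl⟩ := HDG.exists_eq_const hsol.l_mem
    have hloc : ∀ e, HDG.LocalMonotone G e lam (HDG.numFlux G e (τ e) (u e) (q e) lam) ∧
        ((∀ n, 0 ≤ lam n) → ∀ x ∈ G.dom e, 0 ≤ u e x) := by
      intro e
      obtain ⟨a, b, n₀, n₁, hedge⟩ := G.exists_isEdge e
      have hs := hsol.localSolution e
      rcases hUQ e with ⟨hU, hQ⟩ | ⟨hU, hQ⟩ | ⟨hU, hQ⟩ <;> rw [hU, hQ] at hs
      · exact hedge.P1_P0 (hτ e) (hk e) (hadm.source_nonneg e) hs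
      · exact hedge.P0_P1 (hτ e) (hk e) (hadm.source_nonneg e) hs
      · exact hedge.P0_P0 (hτ e) (hk e) (hadm.source_nonneg e) hs
    have hlam := hsol.nonneg_of_localMonotone hadm fun e => (hloc e).1
    exact ⟨fun e => (hloc e).2 hlam, fun n _ _ => hlam n⟩
  · intro d D ι ν _ _ G τ κ ΓD f g u q l hd hτ hκ hgeo hadm hsol
    obtain ⟨lam, rfl⟩ := HDG.exists_eq_const hsol.l_mem
    have hd0 : d ≠ 0 := by omega
    obtain ⟨hmem, κ₀, hκ₀, hκle⟩ := hκ
    have hlam := hsol.nonneg_of_localMonotone hadm fun e =>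
      (hsol.localSolution e).localMonotone_const_const hd0 (hτ e)
        (HDG.integral_inv_pos (hmem e) hκ₀ (hκle e)) (hadm.integral_source_nonneg e)
        (by simpa only [HDG.bdryIntegral_one] using hgeo e)
    exact ⟨fun n _ _ => hlam n, fun e x _ => (hsol.localSolution e).nonneg_const_const hd0 (hτ e)
      (hadm.integral_source_nonneg e) hlam x⟩
  · intro d D ι ν _ _ G k ΓD f g u q l hd hsimp hk hgeo hadm hsol
    obtain ⟨lam, rfl⟩ := HDG.exists_eq_const hsol.l_mem
    have hd0 : d ≠ 0 := by omega
    have hlam := hsol.nonneg_of_localMonotone hadm fun e =>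
      (hsol.localSolution e).localMonotone_RT0Simplex (hsimp e) hd0 (hk e)
        (hadm.integral_source_nonneg e) (hgeo e)
    exact ⟨fun n _ _ => hlam n, fun e x _ => (hsol.localSolution e).nonneg_RT0Simplex (hsimp e)
      hd0 (hk e) (hadm.integral_source_nonneg e) hlam x⟩
  -- The absolute value only serves to make the function positive at every real argument; aspect
  -- ratios are positive anyway.
  · refine ⟨fun ρ => 8 * (1 + |ρ|) ^ 2, fun ρ => by positivity, ?_⟩
    intro D ι ν _ _ G a b τ k ΓD f g Q u q l hrect hτ hk hQ hadm
    refine ⟨fun Q' hQ' => ⟨HDG.IsHDGSolution.rect_congr hrect hk hQ hQ',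
      HDG.IsHDGSolution.rect_congr hrect hk hQ' hQ⟩, fun hstab hsol => ?_⟩
    obtain ⟨lam, rfl⟩ := HDG.exists_eq_const hsol.l_mem
    have hloc : ∀ e, HDG.LocalMonotone G e lam (HDG.numFlux G e (τ e) (u e) (q e) lam) ∧
        ((∀ n, 0 ≤ lam n) → ∀ x ∈ G.dom e, 0 ≤ u e x) := by
      intro e
      obtain ⟨lo, hi, hr⟩ := (hrect e).exists_isRect
      obtain ⟨h1, h2⟩ := HDG.RT0Rect_le_and_le_Q1 (hQ e)
      exact hr.maximumPrinciple (hτ e) (hk e) h1 h2 (hsol.localSolution e)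
        (hadm.integral_source_nonneg e) (hr.stabilizationBound (hτ e) (hk e) (hstab e))
    have hlam := hsol.nonneg_of_localMonotone hadm fun e => (hloc e).1
    exact ⟨fun n _ _ => hlam n, fun e => (hloc e).2 hlam⟩
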